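/- Let $q\ge 2$ be a real number, and let $H_q(t)=\max(t^2,|t|^q)$ for $t\in\mathbb R$. Let $V:\mathbb R\to\mathbb R$ be a (Lebesgue measurable) function such that $d\mu(x)=e^{-V(x)}\,dx$ is a probability measure on $\mathbb R$. Assume that $V$ is locally bounded, that it is of class $C^2$ in neighbourhoods of $+\infty$ and of $-\infty$, and that (i) $\displaystyle\liminf_{|x|\to\infty}\operatorname{sign}(x)\,V'(x)>0$ (the value $+\infty$ is allowed); (ii) $\displaystyle\lim_{|x|\to\infty}\frac{V''(x)}{V'(x)^2}=0$. Then there exists a constant $\kappa<+\infty$ such that every locally Lipschitz function $f:\mathbb R\to\mathbb R$ satisfies $$\operatorname{Ent}_\mu(f^2)\le\kappa\int H_q\!\left(\frac{f'}{f}\right)f^2\,d\mu$$ if and only if $$\limsup_{|x|\to\infty}\frac{V(x)}{|V'(x)|^q}<\infty .$$ Here, for $g\ge 0$ measurable, $\operatorname{Ent}_\mu(g)=\int g\log g\,d\mu-\left(\int g\,d\mu\right)\log\left(\int g\,d\mu\right)$ if $g\log(1+g)$ is $\mu$-integrable and $\operatorname{Ent}_\mu(g)=+\infty$ otherwise. The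 right-hand integral takes values in $[0,+\infty]$, and its integrand is taken to be $0$ where $f=0$ (for locally Lipschitz $f$, almost every point with $f=0$ also has $f'=0$). -/

import Mathlib

open Filter Topology MeasureTheory
open scoped NNReal ENNReal

noncomputable section

/-- The function `H_q(t) = max (t², |t|^q)`. -/
def modifiedPower (q t : ℝ) : ℝ := max (t ^ 2) (|t| ^ q)

open Classical in
/-- The entropy `Ent_μ(g) = ∫ g log g dμ - (∫ g dμ) log (∫ g dμ)` of a non-negative function `g`
with respect to a probability measure `μ`, as an element of `[0, ∞]`. With the usual convention it
is `+∞` when `g log (1 + g)` is not integrable. Otherwise `g` and `g log g` are integrable and the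
difference is a non-negative real number by Jensen's inequality. -/
def boltzmannEntropy (μ : Measure ℝ) (g : ℝ → ℝ) : ℝ≥0∞ :=
  if Integrable (fun x => g x * Real.log (1 + g x)) μ then
    ENNReal.ofReal ((∫ x, g x * Real.log (g x) ∂μ) - (∫ x, g x ∂μ) * Real.log (∫ x, g x ∂μ))
  else ⊤

/-- The integral `∫ H_q(f'/f) f² dμ ∈ [0, ∞]`. The integrand is zero where `f` vanishes; for a
locally Lipschitz `f`, almost every zero of `f` is also a zero of `f'`. -/
def modifiedEnergy (q : ℝ) (μ : Measure ℝ) (f : ℝ → ℝ) : ℝ≥0∞ :=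
  ∫⁻ x, ENNReal.ofReal (modifiedPower q (deriv f x / f x) * f x ^ 2) ∂μ

/-- The measure `e^{-V(x)} dx` on the real line. -/
def gibbsMeasure (V : ℝ → ℝ) : Measure ℝ :=
  volume.withDensity fun x => ENNReal.ofReal (Real.exp (-V x))

end

/-! ### Locally Lipschitz functions on the line -/

/-! Write `E` for the energy, the integral of `H_q(f'/f) f²`. Beyond some `R`, both `V` and its
reflection satisfy `V ≥ 0`, `V' ≥ c > 0` and `|V''| ≤ V'² / 4` (`IsRegularTail`). On such a tail,
estimates come from integrating a derivative of the form `(g ψ)'` with `ψ` built from `V`; the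
boundary term at the far end has the right sign and is dropped.

Sufficiency. By homogeneity take `∫ f² dμ = 1`. The bound `V' ≥ c` gives a Poincaré inequality,
hence `∫ (|f| - 1)² dμ ≤ C E`. Since `∫ f² = 1`, the entropy is the integral of `f² log f² - f² + 1
≥ 0`, which is at most `5 (|f| - 1)²` where `|f| < 2`. Where `|f| ≥ 2`, the inequality `log (f²
e^{-V}) ≤ f² e^{-V}` gives `f² log f² ≤ (f² e^{-V}) f² + V f²` on the tails. The supremum of `f²
e^{-V}` there is at most `3 + C E` (`sq_mul_exp_le`), while the integral of `f²` over `|f| ≥ 2` is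
at most both `1` and `C E`; so the first term costs `O(E)`.

For the term `V f²`, replace `f²` by `ψ(f)`, where `ψ` (`flatWeight`) is comparable to `s²` for `|s|
≥ 2` and vanishes to high order at `±1`. Integrate by parts against `(V / V') e^{-V}`, whose
derivative is about `-V e^{-V}`. The cross term `ψ(f)' V / V'` is absorbed by a Young inequality
using `V ≤ C V'^q`. Because `ψ(s) ≤ 2 (|s| - 1)²`, the remaining terms are also `O(E)`: the
inequality comes out without an additive constant (`exists_lintegral_flatWeight_mul_le`).

Necessity. Test with `f = min (V - V(a)) 1 ^ m` on `[a, ∞)`. Functions supported in a set `s` have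
entropy at least `(∫ f²) log (1 / μ(s))`. Here `μ(a, ∞) ≤ e^{-V(a)} / c`, `∫ f² dμ ≥ k e^{-V(a)} /
V'(a)` and `E ≤ B V'(a)^{q-1} e^{-V(a)}`. Dividing by `e^{-V(a)}` leaves `V(a) ≤ C V'(a)^q`. -/

theorem LocallyLipschitz.exists_lipschitzOnWith_Icc {f : ℝ → ℝ} (hf : LocallyLipschitz f)
    (a b : ℝ) : ∃ K, LipschitzOnWith K f (Set.Icc a b) :=
  (hf.locallyLipschitzOn (s := Set.Icc a b)).exists_lipschitzOnWith_of_compact isCompact_Icc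

theorem LocallyLipschitz.absolutelyContinuousOnInterval {f : ℝ → ℝ} (hf : LocallyLipschitz f)
    (a b : ℝ) : AbsolutelyContinuousOnInterval f a b := by
  obtain ⟨K, hK⟩ := hf.exists_lipschitzOnWith_Icc (min a b) (max a b)
  exact LipschitzOnWith.absolutelyContinuousOnInterval hK

theorem LocallyLipschitz.exists_abs_deriv_le {f : ℝ → ℝ} (hf : LocallyLipschitz f) (a b : ℝ) :
    ∃ C, ∀ x ∈ Set.Icc a b, |deriv f x| ≤ C := by
  obtain ⟨K, hK⟩ := hf.exists_lipschitzOnWith_Icc (a - 1) (b + 1)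
  refine ⟨K, fun x hx => ?_⟩
  exact norm_deriv_le_of_lipschitzOn
    (Icc_mem_nhds (by linarith [hx.1]) (by linarith [hx.2])) hK

theorem LocallyLipschitz.ae_differentiableAt {f : ℝ → ℝ} (hf : LocallyLipschitz f) :
    ∀ᵐ x, DifferentiableAt ℝ f x := by
  have h : ∀ n : ℕ, ∀ᵐ x : ℝ, x ∈ Set.uIcc (-(n : ℝ)) n → DifferentiableAt ℝ f x := fun n =>
    (hf.absolutelyContinuousOnInterval (-(n : ℝ)) n).ae_differentiableAt
  filter_upwards [ae_all_iff.2 h] with x hx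
  obtain ⟨n, hn⟩ := exists_nat_ge |x|
  refine hx n ?_
  rw [Set.uIcc_of_le (by linarith [abs_nonneg x])]
  exact ⟨by linarith [neg_abs_le x], by linarith [le_abs_self x]⟩

theorem LocallyLipschitz.intervalIntegrable_deriv_sq {f : ℝ → ℝ} (hf : LocallyLipschitz f)
    (a b : ℝ) : IntervalIntegrable (fun x => deriv f x ^ 2) volume a b := by
  obtain ⟨C, hC⟩ := hf.exists_abs_deriv_le (min a b) (max a b)
  have h1 : IntervalIntegrable (fun _ : ℝ => C ^ 2) volume a b := intervalIntegrable_const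
  refine h1.mono_fun ((measurable_deriv f).pow_const 2).aestronglyMeasurable ?_
  refine (ae_restrict_mem measurableSet_uIoc).mono fun x hx => ?_
  have := hC x (Set.uIoc_subset_uIcc hx)
  simp only [Real.norm_eq_abs, abs_pow]
  rw [sq_abs C, ← sq_abs C]
  exact pow_le_pow_left₀ (abs_nonneg _) (this.trans (le_abs_self C)) 2

/-- A zero with non-zero derivative is isolated among the zeros, so these points form a discrete,
hence countable, subset of the line. -/
theorem countable_setOf_eq_zero_deriv_ne_zero (f : ℝ → ℝ) :
    {x | f x = 0 ∧ deriv f x ≠ 0}.Countable := by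
  have : DiscreteTopology {x | f x = 0 ∧ deriv f x ≠ 0} := by
    rw [discreteTopology_subtype_iff]
    rintro x ⟨hx, hx'⟩
    have h := (differentiableAt_of_deriv_ne_zero hx').hasDerivAt.eventually_ne (c := 0) hx'
    refine disjoint_iff.1 (Filter.disjoint_principal_right.2 ?_)
    filter_upwards [h] with y hy using fun h => hy h.1
  exact Set.countable_coe_iff.1 (countable_of_Lindelof_of_discrete)

theorem ae_deriv_eq_zero_of_eq_zero (f : ℝ → ℝ) : ∀ᵐ x, f x = 0 → deriv f x = 0 := by
  have := (countable_setOf_eq_zero_deriv_ne_zero f).ae_notMem volume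
  filter_upwards [this] with x hx h
  by_contra h'
  exact hx ⟨h, h'⟩

theorem LocallyLipschitz.sq {f : ℝ → ℝ} (hf : LocallyLipschitz f) :
    LocallyLipschitz fun x => f x ^ 2 :=
  (ContDiff.locallyLipschitz (𝕂 := ℝ) (f := fun x : ℝ => x ^ 2) (by fun_prop)).comp hf

/-! ### Integrals over half-lines and with respect to Gibbs measures -/

/-- Monotone convergence reduces tail estimates to bounded intervals, where integration by parts
needs no decay of `f` at infinity. -/
theorem setLIntegral_Ioi_le_of_forall_Ioc {μ : Measure ℝ} {g : ℝ → ℝ≥0∞} {R : ℝ} {I : ℝ≥0∞}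
    (h : ∀ N, R ≤ N → ∫⁻ x in Set.Ioc R N, g x ∂μ ≤ I) : ∫⁻ x in Set.Ioi R, g x ∂μ ≤ I := by
  have h1 : Set.Ioi R = ⋃ n : ℕ, Set.Ioc R (R + n) := by
    ext x
    simp only [Set.mem_Ioi, Set.mem_iUnion, Set.mem_Ioc]
    constructor
    · intro hx
      obtain ⟨n, hn⟩ := exists_nat_ge (x - R)
      exact ⟨n, hx, by linarith⟩
    · rintro ⟨n, hx, -⟩
      exact hx
  rw [h1, setLIntegral_iUnion_of_directed]
  · exact iSup_le fun n => h _ (by simp)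
  · refine (Monotone.directed_le fun i j hij => ?_)
    exact Set.Ioc_subset_Ioc_right (by simpa using hij)

theorem aemeasurable_gibbsDensity {V : ℝ → ℝ} (hV : AEMeasurable V volume) :
    AEMeasurable (fun x => ENNReal.ofReal (Real.exp (-V x))) volume :=
  (Real.measurable_exp.comp_aemeasurable hV.neg).ennreal_ofReal

theorem setLIntegral_gibbsMeasure {V : ℝ → ℝ} (hV : AEMeasurable V volume) {k : ℝ → ℝ}
    (hk : Measurable k) {s : Set ℝ} (hs : MeasurableSet s) :
    ∫⁻ x in s, ENNReal.ofReal (k x) ∂gibbsMeasure V =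
      ∫⁻ x in s, ENNReal.ofReal (k x * Real.exp (-V x)) := by
  rw [gibbsMeasure, setLIntegral_withDensity_eq_lintegral_mul₀ (aemeasurable_gibbsDensity hV)
    hk.ennreal_ofReal.aemeasurable hs]
  refine lintegral_congr fun x => ?_
  rw [Pi.mul_apply, ← ENNReal.ofReal_mul (Real.exp_nonneg _), mul_comm]

theorem setLIntegral_Ioc_ofReal {a b : ℝ} (hab : a ≤ b) {k : ℝ → ℝ}
    (hk : IntervalIntegrable k volume a b) (h0 : ∀ x ∈ Set.Ioc a b, 0 ≤ k x) :
    ∫⁻ x in Set.Ioc a b, ENNReal.ofReal (k x) = ENNReal.ofReal (∫ x in a..b, k x) := by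
  rw [intervalIntegral.integral_of_le hab, ofReal_integral_eq_lintegral_ofReal hk.1]
  exact (ae_restrict_mem measurableSet_Ioc).mono h0

theorem ae_gibbsMeasure {V : ℝ → ℝ} {p : ℝ → Prop} (h : ∀ᵐ x, p x) :
    ∀ᵐ x ∂gibbsMeasure V, p x :=
  (withDensity_absolutelyContinuous _ _).ae_le h

theorem gibbsMeasure_comp_neg (V : ℝ → ℝ) :
    gibbsMeasure (fun x => V (-x)) = (gibbsMeasure V).map Neg.neg := by
  ext s hs
  rw [Measure.map_apply measurable_neg hs, gibbsMeasure, gibbsMeasure, withDensity_apply _ hs,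
    withDensity_apply _ (measurable_neg hs)]
  exact ((Measure.measurePreserving_neg (volume : Measure ℝ)).setLIntegral_comp_preimage_emb
    (MeasurableEquiv.neg ℝ).measurableEmbedding
    (fun x => ENNReal.ofReal (Real.exp (-V (-x)))) s).symm.trans (by simp)

theorem setLIntegral_Ioi_gibbsMeasure_comp_neg (V : ℝ → ℝ) (g : ℝ → ℝ≥0∞) (R : ℝ) :
    ∫⁻ x in Set.Ioi R, g (-x) ∂gibbsMeasure (fun x => V (-x)) =
      ∫⁻ x in Set.Iio (-R), g x ∂gibbsMeasure V := by
  have h : (gibbsMeasure V).map Neg.neg = (gibbsMeasure V).map (MeasurableEquiv.neg ℝ) := rfl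
  rw [gibbsMeasure_comp_neg, h, MeasurableEquiv.restrict_map, lintegral_map_equiv]
  simp

/-! ### Integration by parts against the density of a regular tail -/

theorem absolutelyContinuousOnInterval_of_hasDerivAt {ψ ψ' : ℝ → ℝ} {a b : ℝ} (hab : a ≤ b)
    (h : ∀ x ∈ Set.Icc a b, HasDerivAt ψ (ψ' x) x) (h' : ContinuousOn ψ' (Set.Icc a b)) :
    AbsolutelyContinuousOnInterval ψ a b := by
  obtain ⟨C, hC⟩ := isCompact_Icc.exists_bound_of_continuousOn h'
  have : LipschitzOnWith C.toNNReal ψ (Set.uIcc a b) := by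
    rw [Set.uIcc_of_le hab]
    refine (convex_Icc a b).lipschitzOnWith_of_nnnorm_hasDerivWithin_le
      (fun x hx => (h x hx).hasDerivWithinAt) fun x hx => ?_
    rw [← NNReal.coe_le_coe, coe_nnnorm]
    exact (hC x hx).trans (Real.le_coe_toNNReal C)
  exact this.absolutelyContinuousOnInterval

/-- Both terms stay under one integral so that the integrand can be estimated pointwise almost
everywhere. -/
theorem LocallyLipschitz.integral_deriv_mul_add {g ψ ψ' : ℝ → ℝ} {a b : ℝ}
    (hg : LocallyLipschitz g) (hab : a ≤ b) (h : ∀ x ∈ Set.Icc a b, HasDerivAt ψ (ψ' x) x)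
    (h' : ContinuousOn ψ' (Set.Icc a b)) :
    ∫ x in a..b, (deriv g x * ψ x + g x * ψ' x) = g b * ψ b - g a * ψ a := by
  rw [← (hg.absolutelyContinuousOnInterval a b).integral_deriv_mul_eq_sub
    (absolutelyContinuousOnInterval_of_hasDerivAt hab h h')]
  refine intervalIntegral.integral_congr fun x hx => ?_
  rw [Set.uIcc_of_le hab] at hx
  simp only [(h x hx).deriv]

theorem LocallyLipschitz.intervalIntegrable_deriv_mul {g ψ : ℝ → ℝ} {a b : ℝ}
    (hg : LocallyLipschitz g) (hab : a ≤ b) (h : ContinuousOn ψ (Set.Icc a b)) :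
    IntervalIntegrable (fun x => deriv g x * ψ x) volume a b := by
  refine (hg.absolutelyContinuousOnInterval a b).intervalIntegrable_deriv.mul_continuousOn ?_
  rwa [Set.uIcc_of_le hab]

theorem setLIntegral_Ioc_gibbsMeasure {V : ℝ → ℝ} {R : ℝ} (hV : AEMeasurable V volume) {k : ℝ → ℝ}
    (hk : Measurable k) (h0 : ∀ x, 0 ≤ k x) {N : ℝ} (hN : R ≤ N)
    (hi : IntervalIntegrable (fun x => k x * Real.exp (-V x)) volume R N) :
    ∫⁻ x in Set.Ioc R N, ENNReal.ofReal (k x) ∂gibbsMeasure V =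
      ENNReal.ofReal (∫ x in R..N, k x * Real.exp (-V x)) := by
  rw [setLIntegral_gibbsMeasure hV hk measurableSet_Ioc, setLIntegral_Ioc_ofReal hN hi]
  exact fun x _ => mul_nonneg (h0 x) (Real.exp_nonneg _)

/-- `V` is a `C²` function near `[R, ∞)` with `V ≥ 0`, `V' ≥ c > 0` and `|V''| ≤ V'² / 4` there. -/
structure IsRegularTail (V : ℝ → ℝ) (R c : ℝ) : Prop where
  pos : 0 < c
  contDiff : ∃ S < R, ContDiffOn ℝ 2 V (Set.Ioi S)
  nonneg : ∀ x, R ≤ x → 0 ≤ V x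
  le_deriv : ∀ x, R ≤ x → c ≤ deriv V x
  abs_deriv_deriv : ∀ x, R ≤ x → |deriv (deriv V) x| ≤ deriv V x ^ 2 / 4

namespace IsRegularTail

variable {V : ℝ → ℝ} {R c : ℝ}

theorem deriv_pos (h : IsRegularTail V R c) {x : ℝ} (hx : R ≤ x) : 0 < deriv V x :=
  h.pos.trans_le (h.le_deriv x hx)

theorem contDiffAt (h : IsRegularTail V R c) {x : ℝ} (hx : R ≤ x) : ContDiffAt ℝ 2 V x := by
  obtain ⟨S, hS, hV⟩ := h.contDiff
  exact hV.contDiffAt (Ioi_mem_nhds (hS.trans_le hx))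

theorem hasDerivAt (h : IsRegularTail V R c) {x : ℝ} (hx : R ≤ x) :
    HasDerivAt V (deriv V x) x :=
  ((h.contDiffAt hx).differentiableAt (by norm_num)).hasDerivAt

theorem contDiffAt_deriv (h : IsRegularTail V R c) {x : ℝ} (hx : R ≤ x) :
    ContDiffAt ℝ 1 (deriv V) x := by
  obtain ⟨S, hS, hV⟩ := h.contDiff
  exact (hV.deriv_of_isOpen isOpen_Ioi (by norm_num)).contDiffAt (Ioi_mem_nhds (hS.trans_le hx))

theorem hasDerivAt_deriv (h : IsRegularTail V R c) {x : ℝ} (hx : R ≤ x) :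
    HasDerivAt (deriv V) (deriv (deriv V) x) x :=
  ((h.contDiffAt_deriv hx).differentiableAt (by norm_num)).hasDerivAt

theorem continuousAt_deriv_deriv (h : IsRegularTail V R c) {x : ℝ} (hx : R ≤ x) :
    ContinuousAt (deriv (deriv V)) x := by
  obtain ⟨S, hS, hV⟩ := h.contDiff
  have h1 := hV.deriv_of_isOpen (m := 1) isOpen_Ioi (by norm_num)
  have h2 := h1.deriv_of_isOpen (m := 0) isOpen_Ioi (by norm_num)
  exact (h2.contDiffAt (Ioi_mem_nhds (hS.trans_le hx))).continuousAt

theorem continuousOn (h : IsRegularTail V R c) (b : ℝ) : ContinuousOn V (Set.Icc R b) :=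
  fun _ hx => (h.hasDerivAt hx.1).continuousAt.continuousWithinAt

theorem continuousOn_deriv (h : IsRegularTail V R c) (b : ℝ) :
    ContinuousOn (deriv V) (Set.Icc R b) :=
  fun _ hx => (h.hasDerivAt_deriv hx.1).continuousAt.continuousWithinAt

theorem continuousOn_deriv_deriv (h : IsRegularTail V R c) (b : ℝ) :
    ContinuousOn (deriv (deriv V)) (Set.Icc R b) :=
  fun _ hx => (h.continuousAt_deriv_deriv hx.1).continuousWithinAt

theorem continuousOn_exp (h : IsRegularTail V R c) (b : ℝ) :
    ContinuousOn (fun x => Real.exp (-V x)) (Set.Icc R b) :=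
  Real.continuous_exp.comp_continuousOn (h.continuousOn b).neg

theorem hasDerivAt_exp (h : IsRegularTail V R c) {x : ℝ} (hx : R ≤ x) :
    HasDerivAt (fun x => Real.exp (-V x)) (-deriv V x * Real.exp (-V x)) x := by
  simpa [mul_comm] using (h.hasDerivAt hx).neg.exp

theorem mono (h : IsRegularTail V R c) {R' : ℝ} (hR : R ≤ R') : IsRegularTail V R' c where
  pos := h.pos
  contDiff := let ⟨S, hS, hV⟩ := h.contDiff; ⟨S, hS.trans_le hR, hV⟩
  nonneg x hx := h.nonneg x (hR.trans hx)
  le_deriv x hx := h.le_deriv x (hR.trans hx)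
  abs_deriv_deriv x hx := h.abs_deriv_deriv x (hR.trans hx)

theorem integral_deriv_exp (h : IsRegularTail V R c) {g : ℝ → ℝ} (hg : LocallyLipschitz g)
    {N : ℝ} (hN : R ≤ N) :
    ∫ x in R..N, (deriv g x * Real.exp (-V x) + g x * (-deriv V x * Real.exp (-V x))) =
      g N * Real.exp (-V N) - g R * Real.exp (-V R) :=
  hg.integral_deriv_mul_add hN (fun _ hx => h.hasDerivAt_exp hx.1)
    ((h.continuousOn_deriv N).neg.mul (h.continuousOn_exp N))

theorem intervalIntegrable_mul_exp (h : IsRegularTail V R c) {g : ℝ → ℝ} {N : ℝ} (hN : R ≤ N)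
    (hg : ContinuousOn g (Set.Icc R N)) :
    IntervalIntegrable (fun x => g x * Real.exp (-V x)) volume R N := by
  refine ContinuousOn.intervalIntegrable ?_
  rw [Set.uIcc_of_le hN]
  exact hg.mul (h.continuousOn_exp N)

theorem intervalIntegrable_deriv_sq_mul_exp (h : IsRegularTail V R c) {f : ℝ → ℝ}
    (hf : LocallyLipschitz f) {N : ℝ} (hN : R ≤ N) :
    IntervalIntegrable (fun x => deriv f x ^ 2 * Real.exp (-V x)) volume R N := by
  refine (hf.intervalIntegrable_deriv_sq R N).mul_continuousOn ?_
  rw [Set.uIcc_of_le hN]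
  exact h.continuousOn_exp N

/-- Poincaré inequality on a regular tail. -/
theorem lintegral_sub_sq_le (h : IsRegularTail V R c) (hV : AEMeasurable V volume) {f : ℝ → ℝ}
    (hf : LocallyLipschitz f) :
    ∫⁻ x in Set.Ioi R, ENNReal.ofReal ((f x - f R) ^ 2) ∂gibbsMeasure V ≤
      ENNReal.ofReal (4 / c ^ 2) *
        ∫⁻ x in Set.Ioi R, ENNReal.ofReal (deriv f x ^ 2) ∂gibbsMeasure V := by
  have hc := h.pos
  have hfc := hf.continuous
  refine setLIntegral_Ioi_le_of_forall_Ioc fun N hN => ?_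
  have hi1 : IntervalIntegrable (fun x => (f x - f R) ^ 2 * Real.exp (-V x)) volume R N :=
    h.intervalIntegrable_mul_exp hN (by fun_prop)
  have hi2 := h.intervalIntegrable_deriv_sq_mul_exp hf hN
  have hg : LocallyLipschitz fun x => (f x - f R) ^ 2 :=
    LocallyLipschitz.sq (hf.sub (LocallyLipschitz.const (f R)))
  have hi3 := hg.intervalIntegrable_deriv_mul hN (h.continuousOn_exp N)
  have hi4 : IntervalIntegrable
      (fun x => (f x - f R) ^ 2 * (-deriv V x * Real.exp (-V x))) volume R N := by
    simp_rw [← mul_assoc]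
    exact h.intervalIntegrable_mul_exp hN
      (ContinuousOn.mul (by fun_prop) (h.continuousOn_deriv N).neg)
  have key : 0 ≤ (2 / c) * (∫ x in R..N, deriv f x ^ 2 * Real.exp (-V x)) -
      (c / 2) * ∫ x in R..N, (f x - f R) ^ 2 * Real.exp (-V x) := by
    rw [← intervalIntegral.integral_const_mul, ← intervalIntegral.integral_const_mul,
      ← intervalIntegral.integral_sub (hi2.const_mul _) (hi1.const_mul _)]
    have h1 := h.integral_deriv_exp hg hN
    rw [sub_self, zero_pow two_ne_zero, zero_mul, sub_zero] at h1
    -- The boundary term at `R` vanishes and the one at `N` is non-negative, so the integral of the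
    -- derivative of `(f - f R)² e^{-V}` is non-negative.
    refine (mul_nonneg (sq_nonneg (f N - f R)) (Real.exp_nonneg (-V N))).trans ?_
    rw [← h1]
    refine intervalIntegral.integral_mono_ae_restrict hN (hi3.add hi4)
      ((hi2.const_mul _).sub (hi1.const_mul _)) ?_
    filter_upwards [ae_restrict_mem measurableSet_Icc,
      ae_restrict_of_ae hf.ae_differentiableAt] with x hx hd
    have hd' : deriv (fun x => (f x - f R) ^ 2) x = 2 * (f x - f R) * deriv f x := by
      have := (hd.hasDerivAt.sub_const (f R)).fun_pow 2
      simpa using this.deriv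
    rw [hd']
    have h2 : 2 * (f x - f R) * deriv f x + (f x - f R) ^ 2 * -deriv V x ≤
        2 / c * deriv f x ^ 2 - c / 2 * (f x - f R) ^ 2 := by
      have h3 := mul_le_mul_of_nonneg_left (h.le_deriv x hx.1) (sq_nonneg (f x - f R))
      have h4 : 0 ≤ (2 / c) * (deriv f x - c / 2 * (f x - f R)) ^ 2 := by positivity
      have h5 : (2 / c) * (deriv f x - c / 2 * (f x - f R)) ^ 2 =
          2 / c * deriv f x ^ 2 - 2 * (f x - f R) * deriv f x + c / 2 * (f x - f R) ^ 2 := by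
        field_simp
        ring
      linarith
    have := mul_le_mul_of_nonneg_right h2 (Real.exp_nonneg (-V x))
    linarith
  have key' : ∫ x in R..N, (f x - f R) ^ 2 * Real.exp (-V x) ≤
      4 / c ^ 2 * ∫ x in R..N, deriv f x ^ 2 * Real.exp (-V x) := by
    have := mul_nonneg (by positivity : 0 ≤ 2 / c) key
    have h5 : ∀ a b : ℝ, 2 / c * (2 / c * a - c / 2 * b) = 4 / c ^ 2 * a - b := by
      intro a b
      field_simp
      ring
    rw [h5] at this
    linarith
  rw [setLIntegral_Ioc_gibbsMeasure hV (by have := hfc.measurable; fun_prop)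
    (fun x => sq_nonneg _) hN hi1]
  refine (ENNReal.ofReal_le_ofReal key').trans ?_
  rw [ENNReal.ofReal_mul (by positivity),
    ← setLIntegral_Ioc_gibbsMeasure hV ((measurable_deriv f).pow_const 2)
      (fun x => sq_nonneg _) hN hi2]
  gcongr
  exact Set.Ioc_subset_Ioi_self

/-- The derivative of `f² e^{-V}` is `(2 f f' - V' f²) e^{-V}`, at most `(f² + f'²) e^{-V}` because
`V' > 0`. -/
theorem sq_mul_exp_le (h : IsRegularTail V R c) (hV : AEMeasurable V volume) {f : ℝ → ℝ}
    (hf : LocallyLipschitz f) {x : ℝ} (hx : R ≤ x) :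
    ENNReal.ofReal (f x ^ 2 * Real.exp (-V x)) ≤ ENNReal.ofReal (f R ^ 2 * Real.exp (-V R)) +
      ∫⁻ x in Set.Ioi R, ENNReal.ofReal (f x ^ 2 + deriv f x ^ 2) ∂gibbsMeasure V := by
  have hfc := hf.continuous
  have hi1 : IntervalIntegrable (fun x => f x ^ 2 * Real.exp (-V x)) volume R x :=
    h.intervalIntegrable_mul_exp hx (by fun_prop)
  have hi2 := h.intervalIntegrable_deriv_sq_mul_exp hf hx
  have hi : IntervalIntegrable (fun x => (f x ^ 2 + deriv f x ^ 2) * Real.exp (-V x))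
      volume R x := by
    simp_rw [add_mul]
    exact hi1.add hi2
  have hi3 := hf.sq.intervalIntegrable_deriv_mul hx (h.continuousOn_exp x)
  have hi4 : IntervalIntegrable
      (fun x => f x ^ 2 * (-deriv V x * Real.exp (-V x))) volume R x := by
    simp_rw [← mul_assoc]
    exact h.intervalIntegrable_mul_exp hx
      (ContinuousOn.mul (by fun_prop) (h.continuousOn_deriv x).neg)
  have key : f x ^ 2 * Real.exp (-V x) ≤ f R ^ 2 * Real.exp (-V R) +
      ∫ x in R..x, (f x ^ 2 + deriv f x ^ 2) * Real.exp (-V x) := by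
    rw [← sub_le_iff_le_add', ← h.integral_deriv_exp hf.sq hx]
    refine intervalIntegral.integral_mono_ae_restrict hx (hi3.add hi4) hi ?_
    filter_upwards [ae_restrict_mem measurableSet_Icc,
      ae_restrict_of_ae hf.ae_differentiableAt] with y hy hd
    have hd' : deriv (fun x => f x ^ 2) y = 2 * f y * deriv f y := by
      simpa using (hd.hasDerivAt.fun_pow 2).deriv
    rw [hd']
    have h2 : 2 * f y * deriv f y + f y ^ 2 * -deriv V y ≤ f y ^ 2 + deriv f y ^ 2 := by
      have h3 := mul_nonneg (sq_nonneg (f y)) (h.deriv_pos hy.1).le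
      nlinarith [sq_nonneg (f y - deriv f y)]
    have := mul_le_mul_of_nonneg_right h2 (Real.exp_nonneg (-V y))
    linarith
  refine (ENNReal.ofReal_le_ofReal key).trans ?_
  refine ENNReal.ofReal_add_le.trans ?_
  rw [← setLIntegral_Ioc_gibbsMeasure hV
    (by have := hfc.measurable; have := measurable_deriv f; fun_prop)
    (fun x => by positivity) hx hi]
  gcongr
  exact Set.Ioc_subset_Ioi_self

end IsRegularTail

/-! ### A quadratic weight which is flat at `±1` -/

theorem sq_le_modifiedPower (q t : ℝ) : t ^ 2 ≤ modifiedPower q t := le_max_left _ _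

theorem rpow_le_modifiedPower (q t : ℝ) : |t| ^ q ≤ modifiedPower q t := le_max_right _ _

theorem modifiedPower_nonneg (q t : ℝ) : 0 ≤ modifiedPower q t :=
  (sq_nonneg t).trans (sq_le_modifiedPower q t)

theorem measurable_modifiedPower (q : ℝ) : Measurable (modifiedPower q) := by
  unfold modifiedPower
  fun_prop

/-- The function `s ↦ (1 + s²) ((s² - 1) / (1 + s²))^(2m)`. -/
noncomputable def flatWeight (m : ℕ) (s : ℝ) : ℝ :=
  (1 + s ^ 2) * ((s ^ 2 - 1) / (1 + s ^ 2)) ^ (2 * m)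

theorem contDiff_flatWeight (m : ℕ) : ContDiff ℝ 1 (flatWeight m) := by
  have h : ∀ s : ℝ, 1 + s ^ 2 ≠ 0 := fun s => by positivity
  unfold flatWeight
  exact (by fun_prop : ContDiff ℝ 1 fun s : ℝ => 1 + s ^ 2).mul
    ((ContDiff.div (by fun_prop) (by fun_prop) h).pow _)

theorem flatWeight_nonneg (m : ℕ) (s : ℝ) : 0 ≤ flatWeight m s := by
  unfold flatWeight
  rw [pow_mul]
  positivity

theorem abs_sq_sub_one_div_le (s : ℝ) : |(s ^ 2 - 1) / (1 + s ^ 2)| ≤ 1 := by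
  rw [abs_div, abs_of_pos (by positivity : 0 < 1 + s ^ 2), div_le_one (by positivity), abs_le]
  constructor <;> nlinarith [sq_nonneg s]

/-- With `η = (s² - 1) / (1 + s²)` and `|η| ≤ 1`, the exponent `2m` may be lowered to `2`; the
factor `(|s| + 1)² / (1 + s²)` that then remains is at most `2`. -/
theorem flatWeight_le {m : ℕ} (hm : m ≠ 0) (s : ℝ) : flatWeight m s ≤ 2 * (|s| - 1) ^ 2 := by
  unfold flatWeight
  have h0 : 0 < 1 + s ^ 2 := by positivity
  have h1 : ((s ^ 2 - 1) / (1 + s ^ 2)) ^ (2 * m) ≤ ((s ^ 2 - 1) / (1 + s ^ 2)) ^ 2 := by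
    rw [pow_mul]
    refine pow_le_of_le_one (sq_nonneg _) ?_ hm
    exact (sq_le_one_iff_abs_le_one _).2 (abs_sq_sub_one_div_le s)
  refine (mul_le_mul_of_nonneg_left h1 h0.le).trans ?_
  have h2 : (1 + s ^ 2) * ((s ^ 2 - 1) / (1 + s ^ 2)) ^ 2 =
      (|s| - 1) ^ 2 * ((|s| + 1) ^ 2 / (1 + s ^ 2)) := by
    rw [← sq_abs s] at h0 ⊢
    field_simp
    ring
  rw [h2, mul_comm (2 : ℝ)]
  refine mul_le_mul_of_nonneg_left ?_ (sq_nonneg _)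
  rw [div_le_iff₀ h0, ← sq_abs s]
  nlinarith [sq_nonneg (|s| - 1)]

/-- For `s² ≥ 4` the ratio `(s² - 1) / (1 + s²)` is at least `3/5`. -/
theorem sq_le_mul_flatWeight (m : ℕ) {s : ℝ} (hs : 2 ≤ |s|) :
    s ^ 2 ≤ (5 / 3) ^ (2 * m) * flatWeight m s := by
  unfold flatWeight
  have h0 : 0 < 1 + s ^ 2 := by positivity
  have h1 : 4 ≤ s ^ 2 := by rw [← sq_abs]; nlinarith
  have h2 : 1 ≤ 5 / 3 * ((s ^ 2 - 1) / (1 + s ^ 2)) := by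
    rw [← mul_div_assoc, le_div_iff₀ h0]
    linarith
  have h3 := one_le_pow₀ h2 (n := 2 * m)
  rw [mul_pow] at h3
  calc s ^ 2 ≤ (1 + s ^ 2) * 1 := by linarith
    _ ≤ (1 + s ^ 2) * ((5 / 3) ^ (2 * m) * ((s ^ 2 - 1) / (1 + s ^ 2)) ^ (2 * m)) := by gcongr
    _ = _ := by ring

/-- With `η = (s² - 1) / (1 + s²)` the derivative is `2 s η^(2m-1) (η + 4m / (1 + s²))`:
differentiation loses only one power of `η`. -/
theorem abs_deriv_flatWeight_le {m : ℕ} (hm : m ≠ 0) (s : ℝ) :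
    |deriv (flatWeight m) s| ≤
      (2 + 8 * m) * |s| * |(s ^ 2 - 1) / (1 + s ^ 2)| ^ (2 * m - 1) := by
  have h0 : 0 < 1 + s ^ 2 := by positivity
  set η := (s ^ 2 - 1) / (1 + s ^ 2) with hη
  have h1 : HasDerivAt (fun s : ℝ => s ^ 2 - 1) (2 * s) s := by
    simpa using (hasDerivAt_pow 2 s).sub_const 1
  have h2 : HasDerivAt (fun s : ℝ => 1 + s ^ 2) (2 * s) s := by
    simpa using (hasDerivAt_pow 2 s).const_add 1
  have h3 := h2.mul ((h1.div h2 h0.ne').fun_pow (2 * m))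
  have h4 : deriv (flatWeight m) s = 2 * s * η ^ (2 * m - 1) * (η + 4 * m * (1 / (1 + s ^ 2))) := by
    refine h3.deriv.trans ?_
    obtain ⟨k, hk⟩ : ∃ k, 2 * m = k + 1 := ⟨2 * m - 1, by omega⟩
    have hk' : (m : ℝ) = (k + 1) / 2 := by
      have : ((2 * m : ℕ) : ℝ) = ((k + 1 : ℕ) : ℝ) := by rw [hk]
      push_cast at this
      linarith
    simp only [Pi.div_apply, hk, ← hη, Nat.add_sub_cancel, pow_succ η k]
    push_cast
    rw [hk']
    field_simp
    ring
  have h5 : |η + 4 * (m : ℝ) * (1 / (1 + s ^ 2))| ≤ 1 + 4 * (m : ℝ) := by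
    refine (abs_add_le _ _).trans (add_le_add (abs_sq_sub_one_div_le s) ?_)
    rw [abs_of_nonneg (by positivity)]
    refine mul_le_of_le_one_right (by positivity) ?_
    rw [div_le_one h0]
    linarith [sq_nonneg s]
  rw [h4, abs_mul, abs_mul, abs_mul, abs_pow, abs_two]
  calc 2 * |s| * |η| ^ (2 * m - 1) * |η + 4 * m * (1 / (1 + s ^ 2))|
      ≤ 2 * |s| * |η| ^ (2 * m - 1) * (1 + 4 * m) := by gcongr
    _ = _ := by ring

/-- A Young inequality with a weight `e` that may vanish. If `4y ≤ e v` the first term dominates;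
otherwise `e^n ≤ e^(q-1)`, as `e ≤ 1` and `n ≥ q - 1`, so `e^n v^(q-1) ≤ (4y)^(q-1)`. This is why
the order of flatness `2m = n + 1` must be at least `q`. -/
theorem mul_pow_mul_rpow_le {q e v y : ℝ} {n : ℕ} (hq : 1 ≤ q) (hn : q ≤ n + 1) (he0 : 0 ≤ e)
    (he1 : e ≤ 1) (hv : 0 ≤ v) (hy : 0 ≤ y) :
    y * e ^ n * v ^ (q - 1) ≤ 1 / 4 * (e ^ (n + 1) * v ^ q) + (4 * y) ^ q := by
  rcases le_total (4 * y) (e * v) with h | h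
  · have h1 : y * e ^ n * v ^ (q - 1) ≤ 1 / 4 * (e ^ (n + 1) * v ^ q) := by
      have h2 : v ^ q = v * v ^ (q - 1) := by
        rw [← Real.rpow_one_add' hv (by linarith)]
        congr 1
        ring
      rw [h2]
      calc y * e ^ n * v ^ (q - 1) ≤ (e * v / 4) * e ^ n * v ^ (q - 1) := by
            gcongr
            linarith
        _ = _ := by ring
    have : 0 ≤ (4 * y) ^ q := by positivity
    linarith
  · have h1 : e ^ n * v ^ (q - 1) ≤ (4 * y) ^ (q - 1) := by
      have h2 : e ^ n ≤ e ^ (q - 1) := by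
        rw [← Real.rpow_natCast]
        rcases he0.eq_or_lt with rfl | he
        · rcases Nat.eq_zero_or_pos n with rfl | hn'
          · have : q = 1 := le_antisymm (by simpa using hn) hq
            simp [this]
          · rw [Real.zero_rpow (by positivity)]
            exact Real.rpow_nonneg le_rfl _
        · exact Real.rpow_le_rpow_of_exponent_ge he he1 (by linarith)
      calc e ^ n * v ^ (q - 1) ≤ e ^ (q - 1) * v ^ (q - 1) := by gcongr
        _ = (e * v) ^ (q - 1) := (Real.mul_rpow he0 hv).symm
        _ ≤ (4 * y) ^ (q - 1) := by gcongr
    have h3 : (4 * y) ^ q = 4 * y * (4 * y) ^ (q - 1) := by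
      rw [← Real.rpow_one_add' (by positivity) (by linarith)]
      congr 1
      ring
    have h4 : 0 ≤ 1 / 4 * (e ^ (n + 1) * v ^ q) := by positivity
    have h5 : 0 ≤ (4 * y) ^ (q - 1) := by positivity
    calc y * e ^ n * v ^ (q - 1) = y * (e ^ n * v ^ (q - 1)) := by ring
      _ ≤ y * (4 * y) ^ (q - 1) := by gcongr
      _ ≤ 4 * y * (4 * y) ^ (q - 1) := by gcongr; linarith
      _ ≤ _ := by rw [h3]; linarith

theorem deriv_flatWeight_mul_le {q K v φ : ℝ} {m : ℕ} (hq : 2 ≤ q) (hm : q ≤ 2 * m) (hK : 0 ≤ K)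
    (hv : 0 ≤ v) (hφ0 : 0 ≤ φ) (hφ : φ ≤ K * v ^ (q - 1)) (s t : ℝ) :
    deriv (flatWeight m) s * t * φ ≤ 1 / 4 * (flatWeight m s * v ^ q) +
      (4 * ((2 + 8 * m) * K)) ^ q * (modifiedPower q (t / s) * s ^ 2) := by
  have hm0 : m ≠ 0 := by
    rintro rfl
    norm_num at hm
    linarith
  have hrest : 0 ≤ 1 / 4 * (flatWeight m s * v ^ q) +
      (4 * ((2 + 8 * m) * K)) ^ q * (modifiedPower q (t / s) * s ^ 2) := by
    have := flatWeight_nonneg m s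
    have := modifiedPower_nonneg q (t / s)
    positivity
  have hd := abs_deriv_flatWeight_le hm0 s
  -- At `s = 0` the quotient `t / s` carries no information, but the derivative of the weight
  -- vanishes there.
  rcases eq_or_ne s 0 with rfl | hs
  · have : deriv (flatWeight m) 0 = 0 := by simpa using hd
    rw [this, zero_mul, zero_mul]
    exact hrest
  obtain ⟨n, hn⟩ : ∃ n, 2 * m = n + 1 := ⟨2 * m - 1, by omega⟩
  have hnq : q ≤ n + 1 := by
    have : ((2 * m : ℕ) : ℝ) = ((n + 1 : ℕ) : ℝ) := by rw [hn]
    push_cast at this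
    linarith
  set η := (s ^ 2 - 1) / (1 + s ^ 2) with hη
  have h1 := mul_pow_mul_rpow_le (y := (2 + 8 * m) * K * |t / s|) (by linarith) hnq (abs_nonneg η)
    (abs_sq_sub_one_div_le s) hv (by positivity)
  have h2 : (4 * ((2 + 8 * m) * K * |t / s|)) ^ q ≤
      (4 * ((2 + 8 * m) * K)) ^ q * modifiedPower q (t / s) := by
    rw [← mul_assoc, Real.mul_rpow (by positivity) (abs_nonneg _)]
    gcongr
    exact rpow_le_modifiedPower q _
  have h3 : s ^ 2 * (|η| ^ (n + 1) * v ^ q) ≤ flatWeight m s * v ^ q := by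
    rw [← mul_assoc]
    gcongr
    unfold flatWeight
    rw [← hη, ← hn, pow_mul |η|, sq_abs, ← pow_mul]
    gcongr
    · rw [pow_mul]; positivity
    · linarith
  have hts : s ^ 2 * |t / s| = |s| * |t| := by
    rw [abs_div, ← sq_abs s]
    have := abs_ne_zero.2 hs
    field_simp
  calc deriv (flatWeight m) s * t * φ ≤ |deriv (flatWeight m) s * t| * φ :=
        mul_le_mul_of_nonneg_right (le_abs_self _) hφ0
    _ = |deriv (flatWeight m) s| * |t| * φ := by rw [abs_mul]
    _ ≤ ((2 + 8 * m) * |s| * |η| ^ (2 * m - 1)) * |t| * (K * v ^ (q - 1)) := by gcongr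
    _ = (2 + 8 * m) * K * (|s| * |t|) * |η| ^ n * v ^ (q - 1) := by
        rw [hn, Nat.add_sub_cancel]
        ring
    _ = s ^ 2 * ((2 + 8 * m) * K * |t / s| * |η| ^ n * v ^ (q - 1)) := by
        rw [← hts]
        ring
    _ ≤ s ^ 2 * (1 / 4 * (|η| ^ (n + 1) * v ^ q) +
          (4 * ((2 + 8 * m) * K)) ^ q * modifiedPower q (t / s)) := by
        gcongr
        exact h1.trans (by gcongr)
    _ = 1 / 4 * (s ^ 2 * (|η| ^ (n + 1) * v ^ q)) +
          (4 * ((2 + 8 * m) * K)) ^ q * (modifiedPower q (t / s) * s ^ 2) := by ring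
    _ ≤ _ := by gcongr

theorem measurable_modifiedEnergy_integrand (q : ℝ) {f : ℝ → ℝ} (hf : Continuous f) :
    Measurable fun x => modifiedPower q (deriv f x / f x) * f x ^ 2 := by
  have h1 := measurable_deriv f
  have h2 := hf.measurable
  exact ((measurable_modifiedPower q).comp (h1.div h2)).mul (h2.pow_const 2)

/-! ### Integration by parts against `(V / V') e^{-V}` -/

namespace IsRegularTail

variable {V : ℝ → ℝ} {R c : ℝ}

theorem hasDerivAt_div_mul_exp (h : IsRegularTail V R c) {x : ℝ} (hx : R ≤ x) :
    HasDerivAt (fun x => V x / deriv V x * Real.exp (-V x))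
      ((1 - V x * (deriv (deriv V) x / deriv V x ^ 2) - V x) * Real.exp (-V x)) x := by
  have hp := (h.deriv_pos hx).ne'
  convert! ((h.hasDerivAt hx).div (h.hasDerivAt_deriv hx) hp).mul (h.hasDerivAt_exp hx) using 1
  simp only [Pi.div_apply]
  field_simp
  ring

/-- The derivative of `(V / V') e^{-V}` supplies `-V`. The term with `V''` gives back at most `V /
4`, the Young inequality for the cross term another `V / 4`; half of `V` remains, whence the factors
`2` on the right. -/
theorem lintegral_flatWeight_mul_le (h : IsRegularTail V R c) (hV : AEMeasurable V volume)
    {q C₀ : ℝ} {m : ℕ} (hq : 2 ≤ q) (hm : q ≤ 2 * m) (hC₀ : 0 ≤ C₀)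
    (hVq : ∀ x, R ≤ x → V x ≤ C₀ * deriv V x ^ q) {f : ℝ → ℝ} (hf : LocallyLipschitz f)
    (hE : modifiedEnergy q (gibbsMeasure V) f ≠ ⊤) :
    ∫⁻ x in Set.Ioi R, ENNReal.ofReal (flatWeight m (f x) * V x) ∂gibbsMeasure V ≤
      ENNReal.ofReal (2 * (flatWeight m (f R) * (V R / deriv V R * Real.exp (-V R)))) +
      2 * (∫⁻ x, ENNReal.ofReal (flatWeight m (f x)) ∂gibbsMeasure V) +
      2 * ENNReal.ofReal ((4 * ((2 + 8 * m) * C₀ ^ (1 / q))) ^ q) *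
        modifiedEnergy q (gibbsMeasure V) f := by
  have hfc := hf.continuous
  have hψ := contDiff_flatWeight m
  have hψc := hψ.continuous
  have hg : LocallyLipschitz fun x => flatWeight m (f x) := hψ.locallyLipschitz.comp hf
  set B := (4 * ((2 + 8 * m) * C₀ ^ (1 / q))) ^ q with hB
  have hB0 : 0 ≤ B := by positivity
  have hme := measurable_modifiedEnergy_integrand q hfc
  have hen : ∀ x, 0 ≤ modifiedPower q (deriv f x / f x) * f x ^ 2 := fun x =>
    mul_nonneg (modifiedPower_nonneg q _) (sq_nonneg _)
  -- Freezing `V` to the left of `R` gives a globally continuous and non-negative function that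
  -- agrees with `V` on the tail.
  have hcut : ∀ k : ℝ → ℝ, ∫⁻ x in Set.Ioi R, ENNReal.ofReal (k x * V x) ∂gibbsMeasure V =
      ∫⁻ x in Set.Ioi R, ENNReal.ofReal (k x * V (max x R)) ∂gibbsMeasure V := fun k =>
    setLIntegral_congr_fun measurableSet_Ioi fun x hx => by
      simp only [max_eq_left (le_of_lt (Set.mem_Ioi.1 hx))]
  have hVm : Continuous fun x => V (max x R) := by
    rw [continuous_iff_continuousAt]
    intro x
    exact ContinuousAt.comp (f := fun x => max x R)
      (h.hasDerivAt (le_max_right x R)).continuousAt (by fun_prop)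
  have hprod : Continuous fun x => flatWeight m (f x) * V (max x R) := hg.continuous.mul hVm
  rw [hcut]
  refine setLIntegral_Ioi_le_of_forall_Ioc fun N hN => ?_
  have hi1 : IntervalIntegrable (fun x => flatWeight m (f x) * Real.exp (-V x)) volume R N :=
    h.intervalIntegrable_mul_exp hN (by fun_prop)
  have hi2 : IntervalIntegrable (fun x => flatWeight m (f x) * V (max x R) * Real.exp (-V x))
      volume R N := h.intervalIntegrable_mul_exp hN hprod.continuousOn
  have hE' : ∫⁻ x in Set.Ioc R N, ENNReal.ofReal
      (modifiedPower q (deriv f x / f x) * f x ^ 2 * Real.exp (-V x)) ≤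
        modifiedEnergy q (gibbsMeasure V) f := by
    rw [← setLIntegral_gibbsMeasure hV hme measurableSet_Ioc]
    exact setLIntegral_le_lintegral _ _
  -- For `q > 2` the integrand can blow up near zeros of `f`; its integrability comes from the
  -- finite energy.
  have hi3 : IntervalIntegrable
      (fun x => modifiedPower q (deriv f x / f x) * f x ^ 2 * Real.exp (-V x)) volume R N := by
    rw [intervalIntegrable_iff_integrableOn_Ioc_of_le hN]
    refine (lintegral_ofReal_ne_top_iff_integrable ?_ ?_).1 (hE'.trans_lt hE.lt_top).ne
    · exact (hme.aemeasurable.mul (Real.measurable_exp.comp_aemeasurable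
        hV.neg)).aestronglyMeasurable.restrict
    · exact ae_of_all _ fun x => mul_nonneg (hen x) (Real.exp_nonneg _)
  have hφc : ContinuousOn (fun x => V x / deriv V x) (Set.Icc R N) :=
    (h.continuousOn N).div (h.continuousOn_deriv N) fun x hx => (h.deriv_pos hx.1).ne'
  have hψ'c : ContinuousOn (fun x => (1 - V x * (deriv (deriv V) x / deriv V x ^ 2) - V x) *
      Real.exp (-V x)) (Set.Icc R N) := by
    refine ((continuousOn_const.sub ((h.continuousOn N).mul ((h.continuousOn_deriv_deriv N).div
      ((h.continuousOn_deriv N).pow 2) fun x hx => ?_))).sub (h.continuousOn N)).mul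
      (h.continuousOn_exp N)
    exact pow_ne_zero 2 (h.deriv_pos hx.1).ne'
  have hi4 := hg.intervalIntegrable_deriv_mul hN (hφc.mul (h.continuousOn_exp N))
  have hi5 : IntervalIntegrable (fun x => flatWeight m (f x) *
      ((1 - V x * (deriv (deriv V) x / deriv V x ^ 2) - V x) * Real.exp (-V x))) volume R N := by
    refine ContinuousOn.intervalIntegrable ?_
    rw [Set.uIcc_of_le hN]
    exact ContinuousOn.mul (by fun_prop) hψ'c
  have key : -(flatWeight m (f R) * (V R / deriv V R * Real.exp (-V R))) ≤
      (∫ x in R..N, flatWeight m (f x) * Real.exp (-V x)) +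
      B * (∫ x in R..N, modifiedPower q (deriv f x / f x) * f x ^ 2 * Real.exp (-V x)) -
      1 / 2 * ∫ x in R..N, flatWeight m (f x) * V (max x R) * Real.exp (-V x) := by
    rw [← intervalIntegral.integral_const_mul, ← intervalIntegral.integral_const_mul,
      ← intervalIntegral.integral_add hi1 (hi3.const_mul _),
      ← intervalIntegral.integral_sub (hi1.add (hi3.const_mul _)) (hi2.const_mul _)]
    have h1 := hg.integral_deriv_mul_add hN (fun x hx => h.hasDerivAt_div_mul_exp hx.1) hψ'c
    have h2 : 0 ≤ flatWeight m (f N) * (V N / deriv V N * Real.exp (-V N)) :=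
      mul_nonneg (flatWeight_nonneg _ _) (mul_nonneg (div_nonneg (h.nonneg N hN)
        (h.deriv_pos hN).le) (Real.exp_nonneg _))
    have h2' := sub_le_sub_right h2 (flatWeight m (f R) * (V R / deriv V R * Real.exp (-V R)))
    rw [zero_sub, ← h1] at h2'
    refine h2'.trans ?_
    refine intervalIntegral.integral_mono_ae_restrict hN (hi4.add hi5)
      ((hi1.add (hi3.const_mul _)).sub (hi2.const_mul _)) ?_
    filter_upwards [ae_restrict_mem measurableSet_Icc,
      ae_restrict_of_ae hf.ae_differentiableAt] with x hx hd
    have hd' : deriv (fun x => flatWeight m (f x)) x = deriv (flatWeight m) (f x) * deriv f x :=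
      deriv_comp x ((hψ.differentiable (by norm_num)).differentiableAt) hd
    rw [hd', max_eq_left hx.1]
    have hVx := h.nonneg x hx.1
    have hV'x := h.deriv_pos hx.1
    -- With `v = V^(1/q)` the growth hypothesis reads `v ≤ C₀^(1/q) V'`, so `V / V' = v · v^(q-1) /
    -- V' ≤ C₀^(1/q) v^(q-1)`.
    have hφ : V x / deriv V x ≤ C₀ ^ (1 / q) * (V x ^ (1 / q)) ^ (q - 1) := by
      have hq1 : (V x ^ (1 / q)) ^ q = V x := by
        rw [← Real.rpow_mul hVx, one_div_mul_cancel (by linarith), Real.rpow_one]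
      have h3 : V x ^ (1 / q) ≤ C₀ ^ (1 / q) * deriv V x := by
        refine (Real.rpow_le_rpow hVx (hVq x hx.1) (by positivity)).trans ?_
        rw [Real.mul_rpow hC₀ (by positivity), ← Real.rpow_mul hV'x.le,
          mul_one_div_cancel (by linarith), Real.rpow_one]
      rw [div_le_iff₀ hV'x]
      calc V x = V x ^ (1 / q) * (V x ^ (1 / q)) ^ (q - 1) := by
            rw [← Real.rpow_one_add' (by positivity) (by linarith), add_sub_cancel, hq1]
        _ ≤ C₀ ^ (1 / q) * deriv V x * (V x ^ (1 / q)) ^ (q - 1) := by gcongr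
        _ = _ := by ring
    have h4 := deriv_flatWeight_mul_le hq hm (by positivity) (by positivity)
      (div_nonneg hVx hV'x.le) hφ (f x) (deriv f x)
    rw [← Real.rpow_mul hVx, one_div_mul_cancel (by linarith), Real.rpow_one, ← hB] at h4
    have h5 : -(1 / 4) ≤ deriv (deriv V) x / deriv V x ^ 2 := by
      rw [le_div_iff₀ (by positivity)]
      linarith [neg_abs_le (deriv (deriv V) x), h.abs_deriv_deriv x hx.1]
    have h6 := mul_le_mul_of_nonneg_left h5 (mul_nonneg (flatWeight_nonneg m (f x)) hVx)
    have h7 : deriv (flatWeight m) (f x) * deriv f x * (V x / deriv V x) + flatWeight m (f x) *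
        (1 - V x * (deriv (deriv V) x / deriv V x ^ 2) - V x) ≤
        flatWeight m (f x) + B * (modifiedPower q (deriv f x / f x) * f x ^ 2) -
          1 / 2 * (flatWeight m (f x) * V x) := by linarith
    have := mul_le_mul_of_nonneg_right h7 (Real.exp_nonneg (-V x))
    linarith
  have key' : ∫ x in R..N, flatWeight m (f x) * V (max x R) * Real.exp (-V x) ≤
      2 * (flatWeight m (f R) * (V R / deriv V R * Real.exp (-V R))) +
      2 * (∫ x in R..N, flatWeight m (f x) * Real.exp (-V x)) +
      2 * B * (∫ x in R..N, modifiedPower q (deriv f x / f x) * f x ^ 2 * Real.exp (-V x)) := by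
    linarith
  rw [setLIntegral_Ioc_gibbsMeasure hV hprod.measurable
    (fun x => mul_nonneg (flatWeight_nonneg m _) (h.nonneg _ (le_max_right x R))) hN hi2]
  refine (ENNReal.ofReal_le_ofReal key').trans ?_
  refine ENNReal.ofReal_add_le.trans (add_le_add (ENNReal.ofReal_add_le.trans
    (add_le_add le_rfl ?_)) ?_)
  · rw [ENNReal.ofReal_mul zero_le_two, ENNReal.ofReal_ofNat, ← setLIntegral_Ioc_gibbsMeasure hV
      (by fun_prop) (fun x => flatWeight_nonneg m _) hN hi1]
    gcongr
    exact Measure.restrict_le_self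
  · rw [ENNReal.ofReal_mul (by positivity), ENNReal.ofReal_mul zero_le_two, ENNReal.ofReal_ofNat,
      ← setLIntegral_Ioc_ofReal hN hi3 fun x _ => mul_nonneg (hen x) (Real.exp_nonneg _)]
    gcongr

end IsRegularTail

/-! ### Reflection -/

theorem lintegral_gibbsMeasure_comp_neg (V : ℝ → ℝ) (g : ℝ → ℝ≥0∞) :
    ∫⁻ x, g (-x) ∂gibbsMeasure (fun x => V (-x)) = ∫⁻ x, g x ∂gibbsMeasure V := by
  have h : (gibbsMeasure V).map Neg.neg = (gibbsMeasure V).map (MeasurableEquiv.neg ℝ) := rfl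
  rw [gibbsMeasure_comp_neg, h, lintegral_map_equiv]
  simp

theorem LocallyLipschitz.comp_neg {f : ℝ → ℝ} (hf : LocallyLipschitz f) :
    LocallyLipschitz fun x => f (-x) :=
  hf.comp (ContDiff.locallyLipschitz (𝕂 := ℝ) contDiff_neg)

theorem modifiedPower_neg (q t : ℝ) : modifiedPower q (-t) = modifiedPower q t := by
  simp [modifiedPower]

theorem modifiedEnergy_comp_neg (q : ℝ) (V f : ℝ → ℝ) :
    modifiedEnergy q (gibbsMeasure fun x => V (-x)) (fun x => f (-x)) =
      modifiedEnergy q (gibbsMeasure V) f := by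
  rw [modifiedEnergy, modifiedEnergy, ← lintegral_gibbsMeasure_comp_neg V
    fun x => ENNReal.ofReal (modifiedPower q (deriv f x / f x) * f x ^ 2)]
  refine lintegral_congr fun x => ?_
  rw [deriv_comp_neg, neg_div, modifiedPower_neg]

theorem aemeasurable_comp_neg {V : ℝ → ℝ} (hV : AEMeasurable V volume) :
    AEMeasurable (fun x => V (-x)) volume :=
  hV.comp_quasiMeasurePreserving
    (Measure.measurePreserving_neg (volume : Measure ℝ)).quasiMeasurePreserving

theorem isProbabilityMeasure_comp_neg {V : ℝ → ℝ} (h : IsProbabilityMeasure (gibbsMeasure V)) :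
    IsProbabilityMeasure (gibbsMeasure fun x => V (-x)) := by
  rw [gibbsMeasure_comp_neg]
  exact Measure.isProbabilityMeasure_map measurable_neg.aemeasurable

/-! ### The Poincaré inequality -/

/-- Cauchy–Schwarz, obtained from the non-negative integral of `(f' - l)²` with `l` the mean slope.
-/
theorem LocallyLipschitz.sq_sub_le {f : ℝ → ℝ} (hf : LocallyLipschitz f) {a b x y : ℝ}
    (hx : x ∈ Set.Icc a b) (hy : y ∈ Set.Icc a b) :
    (f x - f y) ^ 2 ≤ (b - a) * ∫ t in a..b, deriv f t ^ 2 := by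
  wlog hxy : y ≤ x generalizing x y
  · rw [← neg_sub, neg_sq]
    exact this hy hx (le_of_not_ge hxy)
  have hab : a ≤ b := hx.1.trans hx.2
  have hac := hf.absolutelyContinuousOnInterval y x
  have hi := hac.intervalIntegrable_deriv
  have hi2 := hf.intervalIntegrable_deriv_sq y x
  have hmono : ∫ t in y..x, deriv f t ^ 2 ≤ ∫ t in a..b, deriv f t ^ 2 :=
    intervalIntegral.integral_mono_interval hy.1 hxy hx.2
      (ae_of_all _ fun t => sq_nonneg _) (hf.intervalIntegrable_deriv_sq a b)
  have h0 : 0 ≤ ∫ t in y..x, deriv f t ^ 2 :=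
    intervalIntegral.integral_nonneg hxy fun t _ => sq_nonneg _
  have key : (f x - f y) ^ 2 ≤ (x - y) * ∫ t in y..x, deriv f t ^ 2 := by
    rcases hxy.eq_or_lt with rfl | hlt
    · simp
    have hpos : 0 < x - y := sub_pos.2 hlt
    set l := (f x - f y) / (x - y) with hl
    have h1 : 0 ≤ ∫ t in y..x, (deriv f t ^ 2 - 2 * l * deriv f t + l ^ 2) :=
      intervalIntegral.integral_nonneg hxy fun t _ => by nlinarith [sq_nonneg (deriv f t - l)]
    rw [intervalIntegral.integral_add (hi2.sub (hi.const_mul _)) intervalIntegrable_const,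
      intervalIntegral.integral_sub hi2 (hi.const_mul _), intervalIntegral.integral_const_mul,
      hac.integral_deriv_eq_sub, intervalIntegral.integral_const, smul_eq_mul] at h1
    have h2 : l * (x - y) = f x - f y := by rw [hl]; field_simp
    have h3 := mul_nonneg hpos.le h1
    rw [← h2] at h3 ⊢
    nlinarith
  calc (f x - f y) ^ 2 ≤ (x - y) * ∫ t in y..x, deriv f t ^ 2 := key
    _ ≤ (b - a) * ∫ t in a..b, deriv f t ^ 2 := by
      refine mul_le_mul (by linarith [hx.2, hy.1]) hmono h0 (by linarith)

theorem lintegral_le_three (μ : Measure ℝ) (g : ℝ → ℝ≥0∞) (R : ℝ) :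
    ∫⁻ x, g x ∂μ ≤ ∫⁻ x in Set.Icc (-R) R, g x ∂μ + ∫⁻ x in Set.Ioi R, g x ∂μ +
      ∫⁻ x in Set.Iio (-R), g x ∂μ := by
  have h : Set.Icc (-R) R ∪ Set.Ioi R ∪ Set.Iio (-R) = Set.univ := by
    ext x
    simp only [Set.mem_union, Set.mem_Icc, Set.mem_Ioi, Set.mem_Iio, Set.mem_univ, iff_true]
    by_contra! h
    exact absurd (h.1.1 h.2) (not_lt.2 h.1.2)
  calc ∫⁻ x, g x ∂μ = ∫⁻ x in Set.Icc (-R) R ∪ Set.Ioi R ∪ Set.Iio (-R), g x ∂μ := by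
        rw [h, setLIntegral_univ]
    _ ≤ _ := (lintegral_union_le _ _ _).trans (by gcongr; exact lintegral_union_le _ _ _)

/-- `V` has regular tails at `±∞` and is bounded above in between. -/
structure HasRegularTails (V : ℝ → ℝ) (R c : ℝ) : Prop where
  nonneg : 0 ≤ R
  right : IsRegularTail V R c
  left : IsRegularTail (fun x => V (-x)) R c
  bddAbove : ∃ B, ∀ x ∈ Set.Icc (-R) R, V x ≤ B

namespace HasRegularTails

variable {V : ℝ → ℝ} {R c : ℝ}

/-- On the core `V ≤ B`, so Lebesgue measure is at most `e^B μ` there. -/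
theorem exists_ofReal_sub_sq_le (h : HasRegularTails V R c) (hV : AEMeasurable V volume) :
    ∃ A : ℝ≥0, ∀ f : ℝ → ℝ, LocallyLipschitz f → ∀ x ∈ Set.Icc (-R) R, ∀ y ∈ Set.Icc (-R) R,
      ENNReal.ofReal ((f x - f y) ^ 2) ≤
        A * ∫⁻ x, ENNReal.ofReal (deriv f x ^ 2) ∂gibbsMeasure V := by
  obtain ⟨B, hB⟩ := h.bddAbove
  have hR := h.nonneg
  refine ⟨Real.toNNReal (2 * R * Real.exp B), fun f hf x hx y hy => ?_⟩
  refine (ENNReal.ofReal_le_ofReal (hf.sq_sub_le hx hy)).trans ?_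
  have hab : -R ≤ R := by linarith
  rw [ENNReal.ofReal_mul (by linarith), ← setLIntegral_Ioc_ofReal hab
    (hf.intervalIntegrable_deriv_sq _ _) fun _ _ => sq_nonneg _]
  have h1 : ∫⁻ x in Set.Ioc (-R) R, ENNReal.ofReal (deriv f x ^ 2) ≤
      ENNReal.ofReal (Real.exp B) * ∫⁻ x, ENNReal.ofReal (deriv f x ^ 2) ∂gibbsMeasure V := by
    calc ∫⁻ x in Set.Ioc (-R) R, ENNReal.ofReal (deriv f x ^ 2)
        ≤ ∫⁻ x in Set.Ioc (-R) R, ENNReal.ofReal (Real.exp B) *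
            ENNReal.ofReal (deriv f x ^ 2 * Real.exp (-V x)) := by
          refine setLIntegral_mono' measurableSet_Ioc fun x hx => ?_
          rw [← ENNReal.ofReal_mul (Real.exp_nonneg _)]
          refine ENNReal.ofReal_le_ofReal ?_
          have h2 : 1 ≤ Real.exp B * Real.exp (-V x) := by
            rw [← Real.exp_add]
            exact Real.one_le_exp (by linarith [hB x ⟨hx.1.le, hx.2⟩])
          calc deriv f x ^ 2 = deriv f x ^ 2 * 1 := (mul_one _).symm
            _ ≤ deriv f x ^ 2 * (Real.exp B * Real.exp (-V x)) := by gcongr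
            _ = _ := by ring
      _ = ENNReal.ofReal (Real.exp B) *
            ∫⁻ x in Set.Ioc (-R) R, ENNReal.ofReal (deriv f x ^ 2) ∂gibbsMeasure V := by
          rw [lintegral_const_mul' _ _ ENNReal.ofReal_ne_top, setLIntegral_gibbsMeasure hV
            ((measurable_deriv f).pow_const 2) measurableSet_Ioc]
      _ ≤ _ := by gcongr; exact Measure.restrict_le_self
  refine (mul_le_mul_right h1 _).trans (le_of_eq ?_)
  rw [← mul_assoc, ← ENNReal.ofReal_mul (by linarith)]
  change _ = ENNReal.ofReal _ * _
  congr 2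
  ring

/-- On each tail compare `f` with its value at the endpoint `±R` by the tail Poincaré inequality,
then the endpoint with `y` by the oscillation bound on the core. -/
theorem exists_lintegral_sub_sq_le (h : HasRegularTails V R c) (hV : AEMeasurable V volume)
    (hμ : IsProbabilityMeasure (gibbsMeasure V)) :
    ∃ P : ℝ≥0, ∀ f : ℝ → ℝ, LocallyLipschitz f → ∀ y ∈ Set.Icc (-R) R,
      ∫⁻ x, ENNReal.ofReal ((f x - f y) ^ 2) ∂gibbsMeasure V ≤
        P * ∫⁻ x, ENNReal.ofReal (deriv f x ^ 2) ∂gibbsMeasure V := by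
  obtain ⟨A, hA⟩ := h.exists_ofReal_sub_sq_le hV
  have hR := h.nonneg
  set T : ℝ≥0 := Real.toNNReal (4 / c ^ 2) with hT
  refine ⟨A + (2 * T + 2 * A) + (2 * T + 2 * A), fun f hf y hy => ?_⟩
  have hm : Measurable f := hf.continuous.measurable
  set D := ∫⁻ x, ENNReal.ofReal (deriv f x ^ 2) ∂gibbsMeasure V with hD
  have hright : ∫⁻ x in Set.Ioi R, ENNReal.ofReal ((f x - f R) ^ 2) ∂gibbsMeasure V ≤ T * D :=
    (h.right.lintegral_sub_sq_le hV hf).trans (by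
      change (T : ℝ≥0∞) * _ ≤ _
      gcongr
      exact setLIntegral_le_lintegral _ _)
  have hleft : ∫⁻ x in Set.Iio (-R), ENNReal.ofReal ((f x - f (-R)) ^ 2) ∂gibbsMeasure V ≤
      T * D := by
    rw [← setLIntegral_Ioi_gibbsMeasure_comp_neg V
      (fun x => ENNReal.ofReal ((f x - f (-R)) ^ 2))]
    refine (h.left.lintegral_sub_sq_le (aemeasurable_comp_neg hV) hf.comp_neg).trans ?_
    change (T : ℝ≥0∞) * _ ≤ _
    gcongr
    refine (setLIntegral_le_lintegral _ _).trans (le_of_eq ?_)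
    rw [hD, ← lintegral_gibbsMeasure_comp_neg V fun x => ENNReal.ofReal (deriv f x ^ 2)]
    simp only [deriv_comp_neg, neg_sq]
  have htail : ∀ (s : Set ℝ) (z : ℝ), z ∈ Set.Icc (-R) R →
      ∫⁻ x in s, ENNReal.ofReal ((f x - f z) ^ 2) ∂gibbsMeasure V ≤ T * D →
      ∫⁻ x in s, ENNReal.ofReal ((f x - f y) ^ 2) ∂gibbsMeasure V ≤ (2 * T + 2 * A) * D := by
    intro s z hz hs
    calc ∫⁻ x in s, ENNReal.ofReal ((f x - f y) ^ 2) ∂gibbsMeasure V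
        ≤ ∫⁻ x in s, (2 * ENNReal.ofReal ((f x - f z) ^ 2) + 2 * (A * D)) ∂gibbsMeasure V := by
          refine lintegral_mono fun x => ?_
          calc ENNReal.ofReal ((f x - f y) ^ 2)
              ≤ ENNReal.ofReal (2 * (f x - f z) ^ 2 + 2 * (f z - f y) ^ 2) :=
                ENNReal.ofReal_le_ofReal (by nlinarith [sq_nonneg (f x - f z - (f z - f y))])
            _ = 2 * ENNReal.ofReal ((f x - f z) ^ 2) + 2 * ENNReal.ofReal ((f z - f y) ^ 2) := by
                rw [ENNReal.ofReal_add (by positivity) (by positivity),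
                  ENNReal.ofReal_mul zero_le_two, ENNReal.ofReal_mul zero_le_two,
                  ENNReal.ofReal_ofNat]
            _ ≤ _ := by gcongr; exact hA f hf z hz y hy
      _ = 2 * (∫⁻ x in s, ENNReal.ofReal ((f x - f z) ^ 2) ∂gibbsMeasure V) +
            2 * (A * D) * gibbsMeasure V s := by
          rw [lintegral_add_right _ measurable_const, lintegral_const_mul' _ _ (by simp),
            setLIntegral_const]
      _ ≤ 2 * (T * D) + 2 * (A * D) * 1 := by gcongr; exact prob_le_one
      _ = _ := by ring
  calc ∫⁻ x, ENNReal.ofReal ((f x - f y) ^ 2) ∂gibbsMeasure V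
      ≤ _ := lintegral_le_three _ _ R
    _ ≤ A * D + (2 * T + 2 * A) * D + (2 * T + 2 * A) * D := by
        refine add_le_add (add_le_add ?_ (htail _ R ⟨by linarith, le_rfl⟩ hright))
          (htail _ (-R) ⟨le_rfl, by linarith⟩ hleft)
        calc _ ≤ ∫⁻ _ in Set.Icc (-R) R, A * D ∂gibbsMeasure V :=
              setLIntegral_mono' measurableSet_Icc fun x hx => hA f hf x hx y hy
          _ ≤ A * D := by
              rw [setLIntegral_const]
              exact mul_le_of_le_one_right' prob_le_one
    _ = _ := by push_cast; ring

end HasRegularTails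

/-! ### The entropy estimate for normalized functions -/

/-- With `m = ∫ |f| ≤ 1`, the left side is `2 (1 - m)`, while `∫ (|f| - |b|)² ≥ 1 - m² ≥ 1 - m`. So
when `∫ f² = 1` the constant `1` is a nearly optimal centre. -/
theorem lintegral_abs_sub_one_sq_le {μ : Measure ℝ} [IsProbabilityMeasure μ] {f : ℝ → ℝ}
    (hf : Measurable f) (h1 : ∫⁻ x, ENNReal.ofReal (f x ^ 2) ∂μ = 1) (b : ℝ) :
    ∫⁻ x, ENNReal.ofReal ((|f x| - 1) ^ 2) ∂μ ≤ 2 * ∫⁻ x, ENNReal.ofReal ((f x - b) ^ 2) ∂μ := by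
  have hi : Integrable (fun x => f x ^ 2) μ :=
    (lintegral_ofReal_ne_top_iff_integrable (hf.pow_const 2).aestronglyMeasurable
      (ae_of_all _ fun x => sq_nonneg _)).1 (by simp [h1])
  have hi1 : ∫ x, f x ^ 2 ∂μ = 1 := by
    rw [integral_eq_lintegral_of_nonneg_ae (ae_of_all _ fun x => sq_nonneg _)
      (hf.pow_const 2).aestronglyMeasurable, h1, ENNReal.toReal_one]
  have hia : Integrable (fun x => |f x|) μ := by
    refine ((integrable_const 1).add hi).mono' (by fun_prop) (ae_of_all _ fun x => ?_)
    simp only [Real.norm_eq_abs, abs_abs, Pi.add_apply]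
    rw [← sq_abs (f x)]
    nlinarith [sq_nonneg (|f x| - 1 / 2)]
  set m := ∫ x, |f x| ∂μ with hm
  have hm0 : 0 ≤ m := integral_nonneg fun x => abs_nonneg _
  have hexp : ∀ a : ℝ, (fun x => (|f x| - a) ^ 2) = fun x => f x ^ 2 - 2 * a * |f x| + a ^ 2 := by
    intro a
    funext x
    rw [← sq_abs (f x)]
    ring
  have hia2 : ∀ a : ℝ, Integrable (fun x => (|f x| - a) ^ 2) μ := by
    intro a
    rw [hexp]
    exact (hi.sub (hia.const_mul _)).add (integrable_const _)
  have hint : ∀ a : ℝ, ∫ x, (|f x| - a) ^ 2 ∂μ = 1 - 2 * a * m + a ^ 2 := by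
    intro a
    have hs : Integrable (fun x => f x ^ 2 - 2 * a * |f x|) μ := hi.sub (hia.const_mul _)
    rw [hexp, integral_add hs (integrable_const _),
      integral_sub hi (hia.const_mul _), integral_const_mul, hi1, ← hm]
    simp
  have hm1 : m ≤ 1 := by
    have := hint 1
    have h0 : 0 ≤ ∫ x, (|f x| - 1) ^ 2 ∂μ := integral_nonneg fun x => sq_nonneg _
    linarith
  have hof : ∀ a : ℝ, ∫⁻ x, ENNReal.ofReal ((|f x| - a) ^ 2) ∂μ =
      ENNReal.ofReal (1 - 2 * a * m + a ^ 2) := fun a => by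
    rw [← hint, ofReal_integral_eq_lintegral_ofReal (hia2 a) (ae_of_all _ fun x => sq_nonneg _)]
  calc ∫⁻ x, ENNReal.ofReal ((|f x| - 1) ^ 2) ∂μ
      = ENNReal.ofReal (1 - 2 * 1 * m + 1 ^ 2) := hof 1
    _ ≤ ENNReal.ofReal (2 * (1 - 2 * |b| * m + |b| ^ 2)) :=
        ENNReal.ofReal_le_ofReal (by nlinarith [sq_nonneg (|b| - m)])
    _ = 2 * ∫⁻ x, ENNReal.ofReal ((|f x| - |b|) ^ 2) ∂μ := by
        rw [ENNReal.ofReal_mul zero_le_two, hof, ENNReal.ofReal_ofNat]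
    _ ≤ _ := by
        gcongr 2 * ?_
        refine lintegral_mono fun x => ENNReal.ofReal_le_ofReal ?_
        exact sq_le_sq.2 (abs_abs_sub_abs_le _ _)

theorem lintegral_deriv_sq_le_modifiedEnergy (q : ℝ) (V f : ℝ → ℝ) :
    ∫⁻ x, ENNReal.ofReal (deriv f x ^ 2) ∂gibbsMeasure V ≤
      modifiedEnergy q (gibbsMeasure V) f := by
  refine lintegral_mono_ae (ae_gibbsMeasure ?_)
  filter_upwards [ae_deriv_eq_zero_of_eq_zero f] with x hx
  refine ENNReal.ofReal_le_ofReal ?_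
  rcases eq_or_ne (f x) 0 with h | h
  · simp [hx h, h]
  · calc deriv f x ^ 2 = (deriv f x / f x) ^ 2 * f x ^ 2 := by field_simp
      _ ≤ _ := by gcongr; exact sq_le_modifiedPower q _

namespace HasRegularTails

variable {V : ℝ → ℝ} {R c : ℝ}

theorem reflect (h : HasRegularTails V R c) : HasRegularTails (fun x => V (-x)) R c where
  nonneg := h.nonneg
  right := h.left
  left := by simpa using h.right
  bddAbove := by
    obtain ⟨B, hB⟩ := h.bddAbove
    exact ⟨B, fun x hx => hB _ ⟨by linarith [hx.2], by linarith [hx.1]⟩⟩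

/-- Functions of unit norm deviate from `±1` and grow at most as their energy permits. -/
theorem exists_deviation_le (h : HasRegularTails V R c) (hV : AEMeasurable V volume)
    (hμ : IsProbabilityMeasure (gibbsMeasure V)) (q : ℝ) :
    ∃ P : ℝ≥0, ∀ f : ℝ → ℝ, LocallyLipschitz f →
      ∫⁻ x, ENNReal.ofReal (f x ^ 2) ∂gibbsMeasure V = 1 →
      (∫⁻ x, ENNReal.ofReal ((|f x| - 1) ^ 2) ∂gibbsMeasure V ≤
        P * modifiedEnergy q (gibbsMeasure V) f) ∧
      (∀ y ∈ Set.Icc (-R) R, ENNReal.ofReal ((|f y| - 1) ^ 2) ≤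
        P * modifiedEnergy q (gibbsMeasure V) f) ∧
      (∀ y ∈ Set.Icc (-R) R, ENNReal.ofReal (f y ^ 2) ≤
        2 + P * modifiedEnergy q (gibbsMeasure V) f) := by
  obtain ⟨P, hP⟩ := h.exists_lintegral_sub_sq_le hV hμ
  refine ⟨12 * P, fun f hf hf1 => ?_⟩
  have hR := h.nonneg
  have hm := hf.continuous.measurable
  have hDE := lintegral_deriv_sq_le_modifiedEnergy q V f
  set D := ∫⁻ x, ENNReal.ofReal (deriv f x ^ 2) ∂gibbsMeasure V with hD
  set E := modifiedEnergy q (gibbsMeasure V) f with hE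
  have hS : ∫⁻ x, ENNReal.ofReal ((|f x| - 1) ^ 2) ∂gibbsMeasure V ≤ 2 * (P * E) := by
    refine (lintegral_abs_sub_one_sq_le hm hf1 (f R)).trans ?_
    gcongr
    exact (hP f hf R ⟨by linarith, le_rfl⟩).trans (by gcongr)
  have hpt : ∀ y ∈ Set.Icc (-R) R, ENNReal.ofReal ((|f y| - 1) ^ 2) ≤ 6 * (P * E) := by
    intro y hy
    -- Average over `x` the splitting of `|f y| - 1` through `|f x|`.
    calc ENNReal.ofReal ((|f y| - 1) ^ 2)
        = ∫⁻ _, ENNReal.ofReal ((|f y| - 1) ^ 2) ∂gibbsMeasure V := by simp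
      _ ≤ ∫⁻ x, (2 * ENNReal.ofReal ((|f x| - 1) ^ 2) + 2 * ENNReal.ofReal ((f x - f y) ^ 2))
            ∂gibbsMeasure V := by
          refine lintegral_mono fun x => ?_
          rw [← ENNReal.ofReal_ofNat 2, ← ENNReal.ofReal_mul zero_le_two,
            ← ENNReal.ofReal_mul zero_le_two, ← ENNReal.ofReal_add (by positivity) (by positivity)]
          refine ENNReal.ofReal_le_ofReal ?_
          have h1 : (|f x| - |f y|) ^ 2 ≤ (f x - f y) ^ 2 := sq_le_sq.2 (abs_abs_sub_abs_le _ _)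
          nlinarith [sq_nonneg (|f x| - 1 + (|f x| - |f y|))]
      _ = 2 * (∫⁻ x, ENNReal.ofReal ((|f x| - 1) ^ 2) ∂gibbsMeasure V) +
            2 * ∫⁻ x, ENNReal.ofReal ((f x - f y) ^ 2) ∂gibbsMeasure V := by
          rw [lintegral_add_left (by fun_prop), lintegral_const_mul' _ _ (by simp),
            lintegral_const_mul' _ _ (by simp)]
      _ ≤ 2 * (2 * (P * E)) + 2 * (P * E) := by
          gcongr
          exact (hP f hf y hy).trans (by gcongr)
      _ = 6 * (P * E) := by ring
  have h12 : ((12 * P : ℝ≥0) : ℝ≥0∞) * E = 12 * (P * E) := by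
    push_cast
    ring
  rw [h12]
  refine ⟨hS.trans ?_, fun y hy => (hpt y hy).trans ?_, fun y hy => ?_⟩
  · gcongr; norm_num
  · gcongr; norm_num
  · calc ENNReal.ofReal (f y ^ 2) ≤ ENNReal.ofReal (2 + 2 * (|f y| - 1) ^ 2) := by
          refine ENNReal.ofReal_le_ofReal ?_
          rw [← sq_abs]
          nlinarith [sq_nonneg (|f y| - 2)]
      _ = 2 + 2 * ENNReal.ofReal ((|f y| - 1) ^ 2) := by
          rw [ENNReal.ofReal_add (by norm_num) (by positivity), ENNReal.ofReal_mul zero_le_two,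
            ENNReal.ofReal_ofNat]
      _ ≤ 2 + 2 * (6 * (P * E)) := by gcongr; exact hpt y hy
      _ = _ := by ring

/-- The boundary term at `R` and the integral of the weight, which for a general weight would only
be bounded by constants, are `O(E)` because the weight vanishes quadratically at `±1`. -/
theorem exists_lintegral_flatWeight_mul_le (h : HasRegularTails V R c)
    (hV : AEMeasurable V volume) (hμ : IsProbabilityMeasure (gibbsMeasure V)) {q C₀ : ℝ} {m : ℕ}
    (hq : 2 ≤ q) (hm : q ≤ 2 * m) (hC₀ : 0 ≤ C₀)
    (hVq : ∀ x, R ≤ x → V x ≤ C₀ * deriv V x ^ q) :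
    ∃ T : ℝ≥0, ∀ f : ℝ → ℝ, LocallyLipschitz f →
      ∫⁻ x, ENNReal.ofReal (f x ^ 2) ∂gibbsMeasure V = 1 →
      modifiedEnergy q (gibbsMeasure V) f ≠ ⊤ →
      ∫⁻ x in Set.Ioi R, ENNReal.ofReal (flatWeight m (f x) * V x) ∂gibbsMeasure V ≤
        T * modifiedEnergy q (gibbsMeasure V) f := by
  obtain ⟨P, hP⟩ := h.exists_deviation_le hV hμ q
  set B : ℝ≥0 := Real.toNNReal ((4 * ((2 + 8 * m) * C₀ ^ (1 / q))) ^ q) with hB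
  set A : ℝ≥0 := Real.toNNReal (4 / c) with hA
  refine ⟨A * P + 4 * P + 2 * B, fun f hf hf1 hE => ?_⟩
  obtain ⟨h1, h2, -⟩ := hP f hf hf1
  have hR := h.nonneg
  have hm0 : m ≠ 0 := by
    rintro rfl
    norm_num at hm
    linarith
  set E := modifiedEnergy q (gibbsMeasure V) f with hE'
  have hc := h.right.pos
  refine (h.right.lintegral_flatWeight_mul_le hV hq hm hC₀ hVq hf hE).trans ?_
  have hfirst : ENNReal.ofReal
      (2 * (flatWeight m (f R) * (V R / deriv V R * Real.exp (-V R)))) ≤ A * (P * E) := by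
    have h3 : 2 * (flatWeight m (f R) * (V R / deriv V R * Real.exp (-V R))) ≤
        4 / c * (|f R| - 1) ^ 2 := by
      -- Uses `x e^{-x} ≤ 1` and `V' ≥ c`.
      have h4 : V R / deriv V R * Real.exp (-V R) ≤ 1 / c := by
        have h5 : V R * Real.exp (-V R) ≤ 1 := by
          rw [Real.exp_neg, ← div_eq_mul_inv, div_le_one (Real.exp_pos _)]
          linarith [Real.add_one_le_exp (V R)]
        rw [div_mul_eq_mul_div]
        exact div_le_div₀ zero_le_one h5 hc (h.right.le_deriv R le_rfl)
      calc 2 * (flatWeight m (f R) * (V R / deriv V R * Real.exp (-V R)))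
          ≤ 2 * ((2 * (|f R| - 1) ^ 2) * (1 / c)) := by
            gcongr
            · exact mul_nonneg (div_nonneg (h.right.nonneg R le_rfl)
                (h.right.deriv_pos le_rfl).le) (Real.exp_nonneg _)
            · exact flatWeight_le hm0 _
        _ = _ := by ring
    refine (ENNReal.ofReal_le_ofReal h3).trans ?_
    rw [ENNReal.ofReal_mul (by positivity)]
    change (A : ℝ≥0∞) * _ ≤ _
    gcongr
    exact h2 R ⟨by linarith, le_rfl⟩
  have hsecond : ∫⁻ x, ENNReal.ofReal (flatWeight m (f x)) ∂gibbsMeasure V ≤ 2 * (P * E) := by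
    calc _ ≤ ∫⁻ x, 2 * ENNReal.ofReal ((|f x| - 1) ^ 2) ∂gibbsMeasure V := by
          refine lintegral_mono fun x => ?_
          rw [← ENNReal.ofReal_ofNat 2, ← ENNReal.ofReal_mul zero_le_two]
          exact ENNReal.ofReal_le_ofReal (flatWeight_le hm0 _)
      _ ≤ _ := by
          rw [lintegral_const_mul' _ _ (by simp)]
          gcongr
  calc _ ≤ A * (P * E) + 2 * (2 * (P * E)) + 2 * (B : ℝ≥0∞) * E := by
        gcongr
        exact le_rfl
    _ = _ := by push_cast; ring

end HasRegularTails

/-! ### Pointwise bounds for `s² log s²` -/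

theorem sq_le_four_mul_abs_sub_one_sq {s : ℝ} (hs : 2 ≤ |s|) : s ^ 2 ≤ 4 * (|s| - 1) ^ 2 := by
  rw [← sq_abs]
  nlinarith

/-- Bounding `log |s|` by `|s| - 1` leaves `(|s| - 1)² (2|s| + 1)`. -/
theorem mul_log_sub_le {s : ℝ} (hs : |s| < 2) :
    s ^ 2 * Real.log (s ^ 2) - s ^ 2 + 1 ≤ 5 * (|s| - 1) ^ 2 := by
  rw [← sq_abs s, Real.log_pow]
  push_cast
  rcases (abs_nonneg s).eq_or_lt with h | h
  · rw [← h]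
    norm_num
  · have h1 := Real.log_le_sub_one_of_pos h
    have h2 : |s| ^ 2 * (2 * Real.log |s|) ≤ |s| ^ 2 * (2 * (|s| - 1)) := by gcongr
    nlinarith [mul_nonneg (sq_nonneg (|s| - 1)) (by linarith : 0 ≤ 2 - |s|)]

theorem mul_log_sub_nonneg {x : ℝ} (hx : 0 ≤ x) : 0 ≤ x * Real.log x - x + 1 := by
  rcases hx.eq_or_lt with rfl | h
  · norm_num
  · have h1 := mul_le_mul_of_nonneg_left (Real.one_sub_inv_le_log_of_pos h) hx
    rw [mul_sub, mul_inv_cancel₀ h.ne'] at h1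
    linarith

theorem mul_log_one_add_le {x : ℝ} (hx : 0 ≤ x) :
    x * Real.log (1 + x) ≤ x * Real.log x + 1 := by
  rcases hx.eq_or_lt with rfl | h
  · norm_num
  · have h1 : Real.log (1 + x) = Real.log x + Real.log (1 + x⁻¹) := by
      rw [← Real.log_mul h.ne' (by positivity), mul_add, mul_inv_cancel₀ h.ne', mul_one, add_comm]
    have h2 := Real.log_le_sub_one_of_pos (by positivity : 0 < 1 + x⁻¹)
    have h3 := mul_le_mul_of_nonneg_left h2 hx
    rw [add_sub_cancel_left, mul_inv_cancel₀ h.ne'] at h3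
    rw [h1, mul_add]
    linarith

/-- From `log (s² e^{-v}) ≤ s² e^{-v}` one gets `log s² ≤ s² e^{-v} + v`; multiply by `s²` and pass
from `s²` to the flat weight in the last term. -/
theorem ofReal_sq_mul_log_le {s v : ℝ} {m : ℕ} {M : ℝ≥0∞} (hs : 2 ≤ |s|) (hv : 0 ≤ v)
    (hM : ENNReal.ofReal (s ^ 2 * Real.exp (-v)) ≤ M) :
    ENNReal.ofReal (s ^ 2 * Real.log (s ^ 2)) ≤ M * ENNReal.ofReal (s ^ 2) +
      ENNReal.ofReal ((5 / 3) ^ (2 * m)) * ENNReal.ofReal (flatWeight m s * v) := by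
  have hs0 : s ≠ 0 := by
    rintro rfl
    norm_num at hs
  have hs2 : 0 < s ^ 2 := by positivity
  have h1 : Real.log (s ^ 2) ≤ s ^ 2 * Real.exp (-v) + v := by
    have h2 := Real.log_le_sub_one_of_pos (by positivity : 0 < s ^ 2 * Real.exp (-v))
    rw [Real.log_mul hs2.ne' (Real.exp_ne_zero _), Real.log_exp] at h2
    linarith
  have h3 : s ^ 2 * Real.log (s ^ 2) ≤ s ^ 2 * Real.exp (-v) * s ^ 2 +
      (5 / 3) ^ (2 * m) * (flatWeight m s * v) := by
    have h4 := mul_le_mul_of_nonneg_left h1 hs2.le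
    have h5 := mul_le_mul_of_nonneg_right (sq_le_mul_flatWeight m hs) hv
    linarith
  refine (ENNReal.ofReal_le_ofReal h3).trans ?_
  have hΨ := flatWeight_nonneg m s
  rw [ENNReal.ofReal_add (by positivity) (by positivity),
    ENNReal.ofReal_mul (by positivity : 0 ≤ s ^ 2 * Real.exp (-v)),
    ENNReal.ofReal_mul (by positivity : (0 : ℝ) ≤ (5 / 3) ^ (2 * m))]
  gcongr

/-- The part of `s² log s²` where `|s| ≥ 2`. -/
noncomputable def logTail (s : ℝ) : ℝ≥0∞ :=
  if 2 ≤ |s| then ENNReal.ofReal (s ^ 2 * Real.log (s ^ 2)) else 0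

/-- The part of `s²` where `|s| ≥ 2`. -/
noncomputable def sqTail (s : ℝ) : ℝ≥0∞ :=
  if 2 ≤ |s| then ENNReal.ofReal (s ^ 2) else 0

theorem measurable_sqTail : Measurable sqTail :=
  Measurable.ite (measurableSet_le measurable_const (by fun_prop)) (by fun_prop) measurable_const

theorem sqTail_le (s : ℝ) : sqTail s ≤ ENNReal.ofReal (s ^ 2) := by
  unfold sqTail
  split_ifs <;> simp

theorem sqTail_le_four_mul (s : ℝ) : sqTail s ≤ 4 * ENNReal.ofReal ((|s| - 1) ^ 2) := by
  unfold sqTail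
  split_ifs with h
  · rw [← ENNReal.ofReal_ofNat 4, ← ENNReal.ofReal_mul (by norm_num)]
    exact ENNReal.ofReal_le_ofReal (sq_le_four_mul_abs_sub_one_sq h)
  · exact zero_le

theorem logTail_le {s v : ℝ} (m : ℕ) {M : ℝ≥0∞} (hv : 0 ≤ v)
    (hM : ENNReal.ofReal (s ^ 2 * Real.exp (-v)) ≤ M) :
    logTail s ≤ M * sqTail s +
      ENNReal.ofReal ((5 / 3) ^ (2 * m)) * ENNReal.ofReal (flatWeight m s * v) := by
  unfold logTail sqTail
  split_ifs with h
  · exact ofReal_sq_mul_log_le h hv hM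
  · exact zero_le

theorem ofReal_mul_log_sub_le (s : ℝ) :
    ENNReal.ofReal (s ^ 2 * Real.log (s ^ 2) - s ^ 2 + 1) ≤
      5 * ENNReal.ofReal ((|s| - 1) ^ 2) + logTail s := by
  unfold logTail
  split_ifs with h
  · refine le_add_left (ENNReal.ofReal_le_ofReal ?_)
    rw [← sq_abs s]
    nlinarith
  · rw [add_zero, ← ENNReal.ofReal_ofNat 5, ← ENNReal.ofReal_mul (by norm_num)]
    exact ENNReal.ofReal_le_ofReal (mul_log_sub_le (not_le.1 h))

/-! ### Entropy carried by the region `|f| ≥ 2` -/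

namespace HasRegularTails

variable {V : ℝ → ℝ} {R c : ℝ}

/-- The integral is bounded by `1` and by a multiple of the energy. The second bound is paired with
the constant `3`, the first with the term linear in the energy, so no square of the energy appears.
-/
theorem exists_mul_lintegral_sqTail_le (h : HasRegularTails V R c) (hV : AEMeasurable V volume)
    (hμ : IsProbabilityMeasure (gibbsMeasure V)) (q : ℝ) (B : ℝ≥0) :
    ∃ A : ℝ≥0, ∀ f : ℝ → ℝ, LocallyLipschitz f →
      ∫⁻ x, ENNReal.ofReal (f x ^ 2) ∂gibbsMeasure V = 1 →
      (3 + B * modifiedEnergy q (gibbsMeasure V) f) * ∫⁻ x, sqTail (f x) ∂gibbsMeasure V ≤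
        A * modifiedEnergy q (gibbsMeasure V) f := by
  obtain ⟨P, hP⟩ := h.exists_deviation_le hV hμ q
  refine ⟨3 * (4 * P) + B, fun f hf hf1 => ?_⟩
  obtain ⟨h1, -, -⟩ := hP f hf hf1
  have h2 : ∫⁻ x, sqTail (f x) ∂gibbsMeasure V ≤ 1 := by
    rw [← hf1]
    exact lintegral_mono fun x => sqTail_le _
  have h3 : ∫⁻ x, sqTail (f x) ∂gibbsMeasure V ≤
      4 * (P * modifiedEnergy q (gibbsMeasure V) f) := by
    refine (lintegral_mono fun x => sqTail_le_four_mul _).trans ?_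
    rw [lintegral_const_mul' _ _ (by simp)]
    gcongr
  rw [add_mul]
  calc _ ≤ 3 * (4 * (P * modifiedEnergy q (gibbsMeasure V) f)) +
        B * modifiedEnergy q (gibbsMeasure V) f * 1 := by gcongr
    _ = _ := by push_cast; ring

theorem exists_setLIntegral_Ioi_logTail_le (h : HasRegularTails V R c)
    (hV : AEMeasurable V volume) (hμ : IsProbabilityMeasure (gibbsMeasure V)) {q C₀ : ℝ}
    (hq : 2 ≤ q) (hC₀ : 0 ≤ C₀) (hVq : ∀ x, R ≤ x → V x ≤ C₀ * deriv V x ^ q) :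
    ∃ T : ℝ≥0, ∀ f : ℝ → ℝ, LocallyLipschitz f →
      ∫⁻ x, ENNReal.ofReal (f x ^ 2) ∂gibbsMeasure V = 1 →
      modifiedEnergy q (gibbsMeasure V) f ≠ ⊤ →
      ∫⁻ x in Set.Ioi R, logTail (f x) ∂gibbsMeasure V ≤
        T * modifiedEnergy q (gibbsMeasure V) f := by
  obtain ⟨m, hm⟩ : ∃ m : ℕ, q ≤ 2 * m := by
    obtain ⟨m, hm⟩ := exists_nat_ge q
    exact ⟨m, by linarith⟩
  obtain ⟨P, hP⟩ := h.exists_deviation_le hV hμ q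
  obtain ⟨A, hA⟩ := h.exists_mul_lintegral_sqTail_le hV hμ q (P + 1)
  obtain ⟨T, hT⟩ := h.exists_lintegral_flatWeight_mul_le hV hμ hq hm hC₀ hVq
  set Q : ℝ≥0 := Real.toNNReal ((5 / 3) ^ (2 * m)) with hQ
  refine ⟨A + Q * T, fun f hf hf1 hE => ?_⟩
  have hfm := hf.continuous.measurable
  have hsm : Measurable fun x => sqTail (f x) := measurable_sqTail.comp hfm
  obtain ⟨-, -, h3⟩ := hP f hf hf1
  have hR := h.nonneg
  have hDE := lintegral_deriv_sq_le_modifiedEnergy q V f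
  set E := modifiedEnergy q (gibbsMeasure V) f with hE'
  have hsup : ∀ x, R ≤ x →
      ENNReal.ofReal (f x ^ 2 * Real.exp (-V x)) ≤ 3 + (P + 1 : ℝ≥0) * E := by
    intro x hx
    refine (h.right.sq_mul_exp_le hV hf hx).trans ?_
    have h4 : ENNReal.ofReal (f R ^ 2 * Real.exp (-V R)) ≤ 2 + P * E := by
      refine (ENNReal.ofReal_le_ofReal ?_).trans (h3 R ⟨by linarith, le_rfl⟩)
      refine mul_le_of_le_one_right (sq_nonneg _) (Real.exp_le_one_iff.2 ?_)
      linarith [h.right.nonneg R le_rfl]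
    have h5 : ∫⁻ x in Set.Ioi R, ENNReal.ofReal (f x ^ 2 + deriv f x ^ 2) ∂gibbsMeasure V ≤
        1 + E := by
      refine (setLIntegral_le_lintegral _ _).trans ?_
      calc _ = ∫⁻ x, (ENNReal.ofReal (f x ^ 2) + ENNReal.ofReal (deriv f x ^ 2))
            ∂gibbsMeasure V :=
            lintegral_congr fun x => ENNReal.ofReal_add (sq_nonneg _) (sq_nonneg _)
        _ ≤ 1 + E := by
            rw [lintegral_add_left (by fun_prop), hf1]
            gcongr
    calc _ ≤ (2 + P * E) + (1 + E) := add_le_add h4 h5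
      _ = _ := by push_cast; ring
  calc ∫⁻ x in Set.Ioi R, logTail (f x) ∂gibbsMeasure V
      ≤ ∫⁻ x in Set.Ioi R, ((3 + (P + 1 : ℝ≥0) * E) * sqTail (f x) +
          Q * ENNReal.ofReal (flatWeight m (f x) * V x)) ∂gibbsMeasure V :=
        setLIntegral_mono' measurableSet_Ioi fun x hx =>
          logTail_le m (h.right.nonneg x (le_of_lt hx)) (hsup x (le_of_lt hx))
    _ = (3 + (P + 1 : ℝ≥0) * E) * (∫⁻ x in Set.Ioi R, sqTail (f x) ∂gibbsMeasure V) +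
          Q * ∫⁻ x in Set.Ioi R, ENNReal.ofReal (flatWeight m (f x) * V x) ∂gibbsMeasure V := by
        rw [lintegral_add_left (Measurable.const_mul hsm _),
          lintegral_const_mul _ hsm,
          lintegral_const_mul' _ _ ENNReal.coe_ne_top]
    _ ≤ A * E + Q * (T * E) := by
        refine add_le_add (le_trans ?_ (hA f hf hf1)) (by gcongr; exact hT f hf hf1 hE)
        gcongr
        exact Measure.restrict_le_self
    _ = _ := by push_cast; ring

theorem exists_lintegral_logTail_le (h : HasRegularTails V R c)
    (hV : AEMeasurable V volume) (hμ : IsProbabilityMeasure (gibbsMeasure V)) {q C₀ : ℝ}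
    (hq : 2 ≤ q) (hC₀ : 0 ≤ C₀) (hVq : ∀ x, R ≤ x → V x ≤ C₀ * deriv V x ^ q)
    (hVq' : ∀ x, R ≤ x → V (-x) ≤ C₀ * deriv (fun x => V (-x)) x ^ q) :
    ∃ T : ℝ≥0, ∀ f : ℝ → ℝ, LocallyLipschitz f →
      ∫⁻ x, ENNReal.ofReal (f x ^ 2) ∂gibbsMeasure V = 1 →
      modifiedEnergy q (gibbsMeasure V) f ≠ ⊤ →
      ∫⁻ x, logTail (f x) ∂gibbsMeasure V ≤ T * modifiedEnergy q (gibbsMeasure V) f := by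
  obtain ⟨P, hP⟩ := h.exists_deviation_le hV hμ q
  obtain ⟨A, hA⟩ := h.exists_mul_lintegral_sqTail_le hV hμ q P
  obtain ⟨T₁, hT₁⟩ := h.exists_setLIntegral_Ioi_logTail_le hV hμ hq hC₀ hVq
  obtain ⟨T₂, hT₂⟩ := h.reflect.exists_setLIntegral_Ioi_logTail_le (aemeasurable_comp_neg hV)
    (isProbabilityMeasure_comp_neg hμ) hq hC₀ hVq'
  refine ⟨A + T₁ + T₂, fun f hf hf1 hE => ?_⟩
  have hfm := hf.continuous.measurable
  have hsm : Measurable fun x => sqTail (f x) := measurable_sqTail.comp hfm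
  obtain ⟨-, -, h3⟩ := hP f hf hf1
  have hleft := hT₂ _ hf.comp_neg
    (by rw [lintegral_gibbsMeasure_comp_neg V fun x => ENNReal.ofReal (f x ^ 2), hf1])
    (by rwa [modifiedEnergy_comp_neg])
  rw [modifiedEnergy_comp_neg, setLIntegral_Ioi_gibbsMeasure_comp_neg V fun x => logTail (f x)]
    at hleft
  have hmid : ∫⁻ x in Set.Icc (-R) R, logTail (f x) ∂gibbsMeasure V ≤
      A * modifiedEnergy q (gibbsMeasure V) f := by
    calc _ ≤ ∫⁻ x in Set.Icc (-R) R, (3 + P * modifiedEnergy q (gibbsMeasure V) f) *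
          sqTail (f x) ∂gibbsMeasure V := by
          refine setLIntegral_mono' measurableSet_Icc fun x hx => ?_
          -- On the core `f²` itself is bounded by the energy, so `v = 0` suffices and the
          -- flat-weight term disappears.
          have := logTail_le (s := f x) (v := 0) 0 (M := 3 + P * modifiedEnergy q (gibbsMeasure V) f)
            le_rfl ?_
          · simpa using this
          · rw [neg_zero, Real.exp_zero, mul_one]
            refine (h3 x hx).trans ?_
            gcongr
            norm_num
      _ ≤ _ := by
          rw [lintegral_const_mul _ hsm]
          refine le_trans ?_ (hA f hf hf1)
          gcongr
          exact Measure.restrict_le_self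
  calc _ ≤ _ := lintegral_le_three _ _ R
    _ ≤ A * modifiedEnergy q (gibbsMeasure V) f + T₁ * modifiedEnergy q (gibbsMeasure V) f +
        T₂ * modifiedEnergy q (gibbsMeasure V) f :=
        add_le_add (add_le_add hmid (hT₁ f hf hf1 hE)) hleft
    _ = _ := by push_cast; ring

end HasRegularTails

/-! ### Sufficiency -/

theorem integrable_of_lintegral_ofReal_ne_top {μ : Measure ℝ} {g : ℝ → ℝ} (hg : Measurable g)
    (h0 : ∀ x, 0 ≤ g x) (h : ∫⁻ x, ENNReal.ofReal (g x) ∂μ ≠ ⊤) : Integrable g μ :=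
  (lintegral_ofReal_ne_top_iff_integrable hg.aestronglyMeasurable (ae_of_all _ h0)).1 h

theorem integrable_mul_log_one_add {μ : Measure ℝ} [IsFiniteMeasure μ] {g : ℝ → ℝ}
    (hg : Measurable g) (h0 : ∀ x, 0 ≤ g x) (hi : Integrable (fun x => g x * Real.log (g x)) μ) :
    Integrable (fun x => g x * Real.log (1 + g x)) μ := by
  refine (hi.add (integrable_const (1 : ℝ))).mono' (by fun_prop) (ae_of_all _ fun x => ?_)
  rw [Real.norm_eq_abs, abs_of_nonneg
    (mul_nonneg (h0 x) (Real.log_nonneg (by linarith [h0 x])))]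
  exact mul_log_one_add_le (h0 x)

namespace HasRegularTails

variable {V : ℝ → ℝ} {R c : ℝ}

/-- The integrand `f² log f² - f² + 1` is non-negative and, as `∫ f² = 1`, has the same integral as
`f² log f²`; a bound on its lower integral yields integrability too. -/
theorem exists_integral_mul_log_le (h : HasRegularTails V R c)
    (hV : AEMeasurable V volume) (hμ : IsProbabilityMeasure (gibbsMeasure V)) {q C₀ : ℝ}
    (hq : 2 ≤ q) (hC₀ : 0 ≤ C₀) (hVq : ∀ x, R ≤ x → V x ≤ C₀ * deriv V x ^ q)
    (hVq' : ∀ x, R ≤ x → V (-x) ≤ C₀ * deriv (fun x => V (-x)) x ^ q) :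
    ∃ T : ℝ≥0, ∀ f : ℝ → ℝ, LocallyLipschitz f →
      ∫⁻ x, ENNReal.ofReal (f x ^ 2) ∂gibbsMeasure V = 1 →
      modifiedEnergy q (gibbsMeasure V) f ≠ ⊤ →
      Integrable (fun x => f x ^ 2 * Real.log (f x ^ 2)) (gibbsMeasure V) ∧
      ENNReal.ofReal (∫ x, f x ^ 2 * Real.log (f x ^ 2) ∂gibbsMeasure V) ≤
        T * modifiedEnergy q (gibbsMeasure V) f := by
  obtain ⟨P, hP⟩ := h.exists_deviation_le hV hμ q
  obtain ⟨T, hT⟩ := h.exists_lintegral_logTail_le hV hμ hq hC₀ hVq hVq'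
  refine ⟨5 * P + T, fun f hf hf1 hE => ?_⟩
  have hfm := hf.continuous.measurable
  obtain ⟨h1, -, -⟩ := hP f hf hf1
  have hi : Integrable (fun x => f x ^ 2) (gibbsMeasure V) :=
    integrable_of_lintegral_ofReal_ne_top (by fun_prop) (fun x => sq_nonneg _) (by simp [hf1])
  have hi1 : ∫ x, f x ^ 2 ∂gibbsMeasure V = 1 := by
    rw [integral_eq_lintegral_of_nonneg_ae (ae_of_all _ fun x => sq_nonneg _)
      (hfm.pow_const 2).aestronglyMeasurable, hf1, ENNReal.toReal_one]
  have hle : ∫⁻ x, ENNReal.ofReal (f x ^ 2 * Real.log (f x ^ 2) - f x ^ 2 + 1) ∂gibbsMeasure V ≤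
      (5 * P + T : ℝ≥0) * modifiedEnergy q (gibbsMeasure V) f := by
    calc _ ≤ ∫⁻ x, (5 * ENNReal.ofReal ((|f x| - 1) ^ 2) + logTail (f x)) ∂gibbsMeasure V :=
          lintegral_mono fun x => ofReal_mul_log_sub_le (f x)
      _ = 5 * (∫⁻ x, ENNReal.ofReal ((|f x| - 1) ^ 2) ∂gibbsMeasure V) +
            ∫⁻ x, logTail (f x) ∂gibbsMeasure V := by
          rw [lintegral_add_left (by fun_prop), lintegral_const_mul' _ _ (by simp)]
      _ ≤ 5 * (P * modifiedEnergy q (gibbsMeasure V) f) +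
            T * modifiedEnergy q (gibbsMeasure V) f := by
          gcongr
          exact hT f hf hf1 hE
      _ = _ := by push_cast; ring
  have hnn : ∀ x, 0 ≤ f x ^ 2 * Real.log (f x ^ 2) - f x ^ 2 + 1 := fun x =>
    mul_log_sub_nonneg (sq_nonneg _)
  have hiφ : Integrable (fun x => f x ^ 2 * Real.log (f x ^ 2) - f x ^ 2 + 1) (gibbsMeasure V) :=
    integrable_of_lintegral_ofReal_ne_top (by fun_prop) hnn
      (hle.trans_lt (ENNReal.mul_lt_top ENNReal.coe_lt_top hE.lt_top)).ne
  have heq : (fun x => f x ^ 2 * Real.log (f x ^ 2)) = fun x =>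
      (f x ^ 2 * Real.log (f x ^ 2) - f x ^ 2 + 1) + (f x ^ 2 - 1) := by
    funext x
    ring
  have hi2 : Integrable (fun x => f x ^ 2 - 1) (gibbsMeasure V) := hi.sub (integrable_const 1)
  refine ⟨heq ▸ hiφ.add hi2, ?_⟩
  have h2 : ∫ x, (f x ^ 2 - 1) ∂gibbsMeasure V = 0 := by
    rw [integral_sub hi (integrable_const 1), hi1]
    simp
  rw [heq, integral_add hiφ hi2, h2, add_zero,
    ofReal_integral_eq_lintegral_ofReal hiφ (ae_of_all _ hnn)]
  exact hle

theorem exists_boltzmannEntropy_le (h : HasRegularTails V R c)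
    (hV : AEMeasurable V volume) (hμ : IsProbabilityMeasure (gibbsMeasure V)) {q C₀ : ℝ}
    (hq : 2 ≤ q) (hC₀ : 0 ≤ C₀) (hVq : ∀ x, R ≤ x → V x ≤ C₀ * deriv V x ^ q)
    (hVq' : ∀ x, R ≤ x → V (-x) ≤ C₀ * deriv (fun x => V (-x)) x ^ q) :
    ∃ κ : ℝ≥0, ∀ f : ℝ → ℝ, LocallyLipschitz f →
      boltzmannEntropy (gibbsMeasure V) (fun x => f x ^ 2) ≤
        (κ : ℝ≥0∞) * modifiedEnergy q (gibbsMeasure V) f := by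
  obtain ⟨P, hP⟩ := h.exists_lintegral_sub_sq_le hV hμ
  obtain ⟨T, hT⟩ := h.exists_integral_mul_log_le hV hμ hq hC₀ hVq hVq'
  -- The summand `1` keeps the constant positive, so that its product with an infinite energy is
  -- `⊤`.
  refine ⟨T + 1, fun f hf => ?_⟩
  have hR := h.nonneg
  have hfm := hf.continuous.measurable
  rcases eq_or_ne (modifiedEnergy q (gibbsMeasure V) f) ⊤ with hE | hE
  · rw [hE, ENNReal.mul_top (by simp)]
    exact le_top
  -- Finite energy forces `f ∈ L²(μ)` by the Poincaré inequality, so `f` can be normalized.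
  have hfin : ∫⁻ x, ENNReal.ofReal (f x ^ 2) ∂gibbsMeasure V ≠ ⊤ := by
    have h1 : ∫⁻ x, ENNReal.ofReal ((f x - f R) ^ 2) ∂gibbsMeasure V ≠ ⊤ :=
      ((hP f hf R ⟨by linarith, le_rfl⟩).trans (mul_le_mul_right
        (lintegral_deriv_sq_le_modifiedEnergy q V f) _)).trans_lt
        (ENNReal.mul_lt_top ENNReal.coe_lt_top hE.lt_top) |>.ne
    have h2 : Integrable (fun x => (f x - f R) ^ 2) (gibbsMeasure V) :=
      integrable_of_lintegral_ofReal_ne_top (by fun_prop) (fun x => sq_nonneg _) h1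
    refine (lintegral_ofReal_ne_top_iff_integrable (hfm.pow_const 2).aestronglyMeasurable
      (ae_of_all _ fun x => sq_nonneg _)).2 ?_
    refine ((h2.const_mul 2).add (integrable_const (2 * f R ^ 2))).mono'
      (hfm.pow_const 2).aestronglyMeasurable (ae_of_all _ fun x => ?_)
    rw [Real.norm_eq_abs, abs_of_nonneg (sq_nonneg _)]
    simp only [Pi.add_apply]
    nlinarith [sq_nonneg (f x - 2 * f R)]
  have hi : Integrable (fun x => f x ^ 2) (gibbsMeasure V) :=
    integrable_of_lintegral_ofReal_ne_top (by fun_prop) (fun x => sq_nonneg _) hfin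
  have hint : ENNReal.ofReal (∫ x, f x ^ 2 ∂gibbsMeasure V) =
      ∫⁻ x, ENNReal.ofReal (f x ^ 2) ∂gibbsMeasure V :=
    ofReal_integral_eq_lintegral_ofReal hi (ae_of_all _ fun x => sq_nonneg _)
  set N := ∫ x, f x ^ 2 ∂gibbsMeasure V with hN
  have hN0 : 0 ≤ N := integral_nonneg fun x => sq_nonneg _
  rcases hN0.eq_or_lt with hN0 | hN0
  · have h0 : (fun x => f x ^ 2) =ᵐ[gibbsMeasure V] 0 :=
      (integral_eq_zero_iff_of_nonneg (fun x => sq_nonneg _) hi).1 (hN.symm.trans hN0.symm)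
    have h1 : ∫ x, f x ^ 2 * Real.log (f x ^ 2) ∂gibbsMeasure V = 0 := by
      refine integral_eq_zero_of_ae ?_
      filter_upwards [h0] with x hx
      simp only [Pi.zero_apply] at hx ⊢
      rw [hx, zero_mul]
    have h2 : Integrable (fun x => f x ^ 2 * Real.log (1 + f x ^ 2)) (gibbsMeasure V) := by
      refine (integrable_zero ℝ ℝ (gibbsMeasure V)).congr ?_
      filter_upwards [h0] with x hx
      simp only [Pi.zero_apply] at hx ⊢
      rw [hx, zero_mul]
    rw [boltzmannEntropy, if_pos h2, h1, ← hN, ← hN0]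
    simp
  set a := Real.sqrt N with ha
  have ha0 : 0 < a := Real.sqrt_pos.2 hN0
  have haN : a ^ 2 = N := Real.sq_sqrt hN0.le
  have hg : LocallyLipschitz fun x => a⁻¹ * f x :=
    (ContDiff.locallyLipschitz (𝕂 := ℝ) (f := fun x : ℝ => a⁻¹ * x) (by fun_prop)).comp hf
  have hsq : ∀ x, (a⁻¹ * f x) ^ 2 = N⁻¹ * f x ^ 2 := fun x => by
    rw [mul_pow, inv_pow, haN]
  have hg1 : ∫⁻ x, ENNReal.ofReal ((a⁻¹ * f x) ^ 2) ∂gibbsMeasure V = 1 := by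
    simp_rw [hsq, ENNReal.ofReal_mul (inv_nonneg.2 hN0.le)]
    rw [lintegral_const_mul' _ _ ENNReal.ofReal_ne_top, ← hint,
      ← ENNReal.ofReal_mul (inv_nonneg.2 hN0.le), inv_mul_cancel₀ hN0.ne', ENNReal.ofReal_one]
  have hgE : modifiedEnergy q (gibbsMeasure V) (fun x => a⁻¹ * f x) =
      ENNReal.ofReal N⁻¹ * modifiedEnergy q (gibbsMeasure V) f := by
    rw [modifiedEnergy, modifiedEnergy, ← lintegral_const_mul' _ _ ENNReal.ofReal_ne_top]
    refine lintegral_congr fun x => ?_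
    rw [← ENNReal.ofReal_mul (inv_nonneg.2 hN0.le), hsq, deriv_const_mul_field,
      mul_div_mul_left _ _ (inv_ne_zero ha0.ne')]
    congr 1
    ring
  obtain ⟨h1, h2⟩ := hT _ hg hg1
    (by rw [hgE]; exact ENNReal.mul_ne_top ENNReal.ofReal_ne_top hE)
  have heq : (fun x => f x ^ 2 * Real.log (f x ^ 2)) = fun x =>
      N * ((a⁻¹ * f x) ^ 2 * Real.log ((a⁻¹ * f x) ^ 2)) + Real.log N * f x ^ 2 := by
    funext x
    rw [hsq]
    rcases eq_or_ne (f x ^ 2) 0 with h0 | h0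
    · simp [h0]
    · rw [Real.log_mul (inv_ne_zero hN0.ne') h0, Real.log_inv]
      field_simp
      ring
  have h3 : Integrable (fun x => f x ^ 2 * Real.log (f x ^ 2)) (gibbsMeasure V) := by
    rw [heq]
    exact (h1.const_mul _).add (hi.const_mul _)
  rw [boltzmannEntropy,
    if_pos (integrable_mul_log_one_add (hfm.pow_const 2) (fun x => sq_nonneg _) h3), heq,
    integral_add (h1.const_mul _) (hi.const_mul _), integral_const_mul, integral_const_mul, ← hN,
    mul_comm (Real.log N), add_sub_cancel_right, ENNReal.ofReal_mul hN0.le]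
  calc _ ≤ ENNReal.ofReal N * (T * (ENNReal.ofReal N⁻¹ * modifiedEnergy q (gibbsMeasure V) f)) := by
        rw [← hgE]
        gcongr
    _ = ENNReal.ofReal (N * N⁻¹) * (T * modifiedEnergy q (gibbsMeasure V) f) := by
        rw [ENNReal.ofReal_mul hN0.le]
        ring
    _ = T * modifiedEnergy q (gibbsMeasure V) f := by
        rw [mul_inv_cancel₀ hN0.ne', ENNReal.ofReal_one, one_mul]
    _ ≤ _ := by
        gcongr
        simp

end HasRegularTails

/-! ### Necessity -/

/-- Jensen on `s`, through the tangent line of `x log x` at the mean `b = l / μ(s)`: `x log x ≥ x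
log b + x - b`. Integration gives `∫ g log g ≥ l log b`. -/
theorem mul_le_integral_mul_log {μ : Measure ℝ} [IsFiniteMeasure μ] {g : ℝ → ℝ} {s : Set ℝ}
    (hs : MeasurableSet s) (hg : Measurable g) (h0 : ∀ x, 0 ≤ g x) (h1 : ∀ x, g x ≤ 1)
    (hgs : ∀ x ∉ s, g x = 0) (hpos : 0 < ∫ x, g x ∂μ) :
    Integrable (fun x => g x * Real.log (1 + g x)) μ ∧
    (∫ x, g x ∂μ) * -Real.log (μ.real s) ≤
      (∫ x, g x * Real.log (g x) ∂μ) - (∫ x, g x ∂μ) * Real.log (∫ x, g x ∂μ) := by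
  have hi : Integrable g μ := Integrable.of_bound hg.aestronglyMeasurable 1
    (ae_of_all _ fun x => by rw [Real.norm_eq_abs, abs_of_nonneg (h0 x)]; exact h1 x)
  have hil : Integrable (fun x => g x * Real.log (g x)) μ := by
    refine Integrable.of_bound (by fun_prop) 1 (ae_of_all _ fun x => ?_)
    rw [Real.norm_eq_abs, abs_le]
    exact ⟨by linarith [mul_log_sub_nonneg (h0 x), h0 x],
      (mul_nonpos_of_nonneg_of_nonpos (h0 x) (Real.log_nonpos (h0 x) (h1 x))).trans zero_le_one⟩
  refine ⟨integrable_mul_log_one_add hg h0 hil, ?_⟩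
  set l := ∫ x, g x ∂μ with hl
  have hs0 : 0 < μ.real s := by
    rw [measureReal_def, ENNReal.toReal_pos_iff]
    refine ⟨pos_iff_ne_zero.2 fun h => hpos.ne' ?_, measure_lt_top _ _⟩
    refine integral_eq_zero_of_ae ?_
    filter_upwards [measure_eq_zero_iff_ae_notMem.1 h] with x hx using hgs x hx
  set b := l / μ.real s with hb
  have hb0 : 0 < b := div_pos hpos hs0
  have his : Integrable (s.indicator fun _ => (1 : ℝ)) μ := (integrable_const 1).indicator hs
  have hpt : ∀ x, Real.log b * g x + g x - b * s.indicator (fun _ => (1 : ℝ)) x ≤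
      g x * Real.log (g x) := by
    intro x
    by_cases hx : x ∈ s
    · rw [Set.indicator_of_mem hx]
      have h2 := mul_log_sub_nonneg (div_nonneg (h0 x) hb0.le)
      rcases (h0 x).eq_or_lt with h3 | h3
      · rw [← h3]
        linarith
      · rw [Real.log_div h3.ne' hb0.ne'] at h2
        have h4 := mul_nonneg hb0.le h2
        have h5 : b * (g x / b * (Real.log (g x) - Real.log b) - g x / b + 1) =
            g x * (Real.log (g x) - Real.log b) - g x + b := by
          field_simp
        linarith
    · rw [Set.indicator_of_notMem hx, hgs x hx]
      simp
  have hi1 : Integrable (fun x => Real.log b * g x + g x) μ := (hi.const_mul _).add hi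
  have h2 := integral_mono (hi1.sub (his.const_mul b)) hil hpt
  have h3 : ∫ x, (Real.log b * g x + g x - b * s.indicator (fun _ => (1 : ℝ)) x) ∂μ =
      Real.log b * l := by
    rw [integral_sub hi1 (his.const_mul b), integral_add (hi.const_mul _) hi, integral_const_mul,
      integral_const_mul, integral_indicator_const _ hs, ← hl, hb]
    simp only [smul_eq_mul, mul_one]
    field_simp
    ring
  have h4 : Real.log b = Real.log l - Real.log (μ.real s) := Real.log_div hpos.ne' hs0.ne'
  have h5 : Real.log b * l ≤ ∫ x, g x * Real.log (g x) ∂μ := h3 ▸ h2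
  rw [h4] at h5
  linarith

/-- The function `min (V - V a) 1 ^ m` on `[a, ∞)`, extended by zero. -/
noncomputable def tailTest (V : ℝ → ℝ) (a : ℝ) (m : ℕ) (y : ℝ) : ℝ :=
  min (V (max y a) - V a) 1 ^ m

/-! ### Growth of `V` and mass of a regular tail -/

namespace IsRegularTail

variable {V : ℝ → ℝ} {R c : ℝ}

theorem mul_sub_le (h : IsRegularTail V R c) {x y : ℝ} (hx : R ≤ x) (hxy : x ≤ y) :
    c * (y - x) ≤ V y - V x := by
  refine (convex_Icc R y).mul_sub_le_image_sub_of_le_deriv (h.continuousOn y) ?_ ?_ x ⟨hx, hxy⟩ y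
    ⟨hx.trans hxy, le_rfl⟩ hxy
  · intro z hz
    exact (h.hasDerivAt (interior_subset hz).1).differentiableAt.differentiableWithinAt
  · intro z hz
    exact h.le_deriv z (interior_subset hz).1

/-- The function `V' e^{-V}` is non-increasing, its derivative being `(V'' - V'²) e^{-V} ≤ 0`. Thus
`V'` grows at most by a factor `e` while `V` increases by one. -/
theorem deriv_le (h : IsRegularTail V R c) {x y : ℝ} (hx : R ≤ x) (hxy : x ≤ y) :
    deriv V y ≤ Real.exp (V y - V x) * deriv V x := by
  have hd : ∀ z, R ≤ z → HasDerivAt (fun z => deriv V z * Real.exp (-V z))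
      ((deriv (deriv V) z - deriv V z ^ 2) * Real.exp (-V z)) z := fun z hz => by
    convert! (h.hasDerivAt_deriv hz).mul (h.hasDerivAt_exp hz) using 1
    ring
  have hanti : AntitoneOn (fun z => deriv V z * Real.exp (-V z)) (Set.Icc R y) := by
    refine antitoneOn_of_deriv_nonpos (convex_Icc R y)
      (fun z hz => (hd z hz.1).continuousAt.continuousWithinAt)
      (fun z hz => (hd z (interior_subset hz).1).differentiableAt.differentiableWithinAt)
      fun z hz => ?_
    have hz' := (interior_subset hz).1
    rw [(hd z hz').deriv]
    refine mul_nonpos_of_nonpos_of_nonneg ?_ (Real.exp_nonneg _)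
    have := h.abs_deriv_deriv z hz'
    nlinarith [le_abs_self (deriv (deriv V) z), sq_nonneg (deriv V z)]
  have h1 := hanti ⟨hx, hxy⟩ ⟨hx.trans hxy, le_rfl⟩ hxy
  simp only at h1
  calc deriv V y = deriv V y * Real.exp (-V y) * Real.exp (V y) := by
        rw [mul_assoc, ← Real.exp_add, neg_add_cancel, Real.exp_zero, mul_one]
    _ ≤ deriv V x * Real.exp (-V x) * Real.exp (V y) := by gcongr
    _ = _ := by
        rw [sub_eq_add_neg, Real.exp_add]
        ring

theorem integral_deriv_mul_exp (h : IsRegularTail V R c) {x y : ℝ} (hx : R ≤ x) (hxy : x ≤ y) :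
    ∫ z in x..y, deriv V z * Real.exp (-V z) = Real.exp (-V x) - Real.exp (-V y) := by
  have h1 : ∫ z in x..y, -deriv V z * Real.exp (-V z) = Real.exp (-V y) - Real.exp (-V x) := by
    refine intervalIntegral.integral_eq_sub_of_hasDerivAt (f := fun z => Real.exp (-V z))
      (fun z hz => ?_) ?_
    · rw [Set.uIcc_of_le hxy] at hz
      exact h.hasDerivAt_exp (hx.trans hz.1)
    · exact (h.mono hx).intervalIntegrable_mul_exp hxy ((h.mono hx).continuousOn_deriv y).neg
  simp only [neg_mul, intervalIntegral.integral_neg] at h1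
  linarith

/-- Bound `1` by `V' / c` and integrate `V' e^{-V}` exactly. -/
theorem gibbsMeasure_Ioi_le (h : IsRegularTail V R c) (hV : AEMeasurable V volume) {x : ℝ}
    (hx : R ≤ x) : gibbsMeasure V (Set.Ioi x) ≤ ENNReal.ofReal (Real.exp (-V x) / c) := by
  have hc := h.pos
  have h1 : ∫⁻ _ in Set.Ioi x, ENNReal.ofReal 1 ∂gibbsMeasure V ≤
      ENNReal.ofReal (Real.exp (-V x) / c) := by
    refine setLIntegral_Ioi_le_of_forall_Ioc fun N hN => ?_
    have hi : IntervalIntegrable (fun z => 1 * Real.exp (-V z)) volume x N :=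
      (h.mono hx).intervalIntegrable_mul_exp hN continuousOn_const
    rw [setLIntegral_Ioc_gibbsMeasure hV measurable_const (fun _ => zero_le_one) hN hi]
    refine ENNReal.ofReal_le_ofReal ?_
    rw [le_div_iff₀ hc, ← intervalIntegral.integral_mul_const]
    calc ∫ z in x..N, 1 * Real.exp (-V z) * c ≤ ∫ z in x..N, deriv V z * Real.exp (-V z) := by
          refine intervalIntegral.integral_mono_on hN (hi.mul_const _)
            ((h.mono hx).intervalIntegrable_mul_exp hN ((h.mono hx).continuousOn_deriv N))
            fun z hz => ?_
          rw [one_mul, mul_comm]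
          exact mul_le_mul_of_nonneg_right (h.le_deriv z (hx.trans hz.1)) (Real.exp_nonneg _)
      _ ≤ Real.exp (-V x) := by
          rw [h.integral_deriv_mul_exp hx hN]
          linarith [Real.exp_pos (-V N)]
  simpa using h1

theorem locallyLipschitz_tailTest (h : IsRegularTail V R c) {a : ℝ} (ha : R ≤ a) (m : ℕ) :
    LocallyLipschitz (tailTest V a m) := by
  have h1 : LocallyLipschitz fun y => V (max y a) := by
    intro y
    obtain ⟨K, t, ht, hK⟩ := ((h.contDiffAt (ha.trans (le_max_right y a))).of_le
      (by norm_num : (1 : WithTop ℕ∞) ≤ 2)).exists_lipschitzOnWith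
    have hmax : LipschitzWith 1 fun y : ℝ => max y a := LipschitzWith.id.max_const a
    refine ⟨K * 1, (fun y => max y a) ⁻¹' t, hmax.continuous.continuousAt.preimage_mem_nhds ht, ?_⟩
    exact hK.comp hmax.lipschitzOnWith (fun z hz => hz)
  have h2 : LocallyLipschitz fun z : ℝ => min z 1 := (LipschitzWith.id.min_const 1).locallyLipschitz
  exact (ContDiff.locallyLipschitz (𝕂 := ℝ) (f := fun x : ℝ => x ^ m) (by fun_prop)).comp
    (h2.comp (h1.sub (LocallyLipschitz.const (V a))))

theorem exists_eq_add (h : IsRegularTail V R c) {a : ℝ} (ha : R ≤ a) {t : ℝ} (ht : 0 ≤ t) :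
    ∃ b, a ≤ b ∧ V b = V a + t := by
  have hc := h.pos
  have hle : a ≤ a + t / c := by
    have := div_nonneg ht hc.le
    linarith
  have h1 := h.mul_sub_le ha hle
  rw [add_sub_cancel_left, mul_div_cancel₀ _ hc.ne'] at h1
  obtain ⟨b, hb, hb'⟩ := intermediate_value_Icc hle ((h.mono ha).continuousOn _)
    (⟨by linarith, by linarith⟩ : V a + t ∈ Set.Icc (V a) (V (a + t / c)))
  exact ⟨b, hb.1, hb'⟩

end IsRegularTail

theorem tailTest_of_le {V : ℝ → ℝ} {a y : ℝ} {m : ℕ} (hm : m ≠ 0) (hy : y ≤ a) :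
    tailTest V a m y = 0 := by
  simp [tailTest, max_eq_right hy, hm]

/-- The factor `w^(2m)` with `2m ≥ q` absorbs the singularity `w^(-q)` of the logarithmic derivative
at the edge of the support; this dictates the power `m` in the test function. -/
theorem modifiedPower_div_mul_le {q s w : ℝ} {m : ℕ} (hm0 : m ≠ 0) (hm : q ≤ 2 * m)
    (hs : 0 ≤ s) (hw : 0 < w) (hw1 : w ≤ 1) :
    modifiedPower q (s / w) * (w ^ m) ^ 2 ≤ s ^ 2 + s ^ q := by
  have h1 : (s / w) ^ 2 * (w ^ m) ^ 2 ≤ s ^ 2 := by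
    rw [← mul_pow]
    refine pow_le_pow_left₀ (by positivity) ?_ 2
    rw [div_mul_eq_mul_div, div_le_iff₀ hw]
    exact mul_le_mul_of_nonneg_left (pow_le_of_le_one hw.le hw1 hm0) hs
  have h2 : |s / w| ^ q * (w ^ m) ^ 2 ≤ s ^ q := by
    rw [abs_of_nonneg (by positivity), Real.div_rpow hs hw.le, div_mul_eq_mul_div,
      div_le_iff₀ (by positivity), ← pow_mul]
    refine mul_le_mul_of_nonneg_left ?_ (by positivity)
    rw [← Real.rpow_natCast]
    refine Real.rpow_le_rpow_of_exponent_ge hw hw1 ?_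
    push_cast
    linarith
  unfold modifiedPower
  rw [max_mul_of_nonneg _ _ (by positivity)]
  refine max_le (h1.trans ?_) (h2.trans ?_)
  · linarith [Real.rpow_nonneg hs q]
  · linarith [sq_nonneg s]

/-! ### Energy and norm of the test functions -/

namespace IsRegularTail

variable {V : ℝ → ℝ} {R c : ℝ}

theorem tailTest_mem_Icc (h : IsRegularTail V R c) {a : ℝ} (ha : R ≤ a) (m : ℕ) (y : ℝ) :
    tailTest V a m y ∈ Set.Icc 0 1 := by
  have h1 : 0 ≤ min (V (max y a) - V a) 1 := by
    refine le_min ?_ zero_le_one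
    refine le_trans ?_ (h.mul_sub_le ha (le_max_right y a))
    exact mul_nonneg h.pos.le (by linarith [le_max_right y a])
  exact ⟨pow_nonneg h1 m, pow_le_one₀ h1 (min_le_right _ _)⟩

theorem hasDerivAt_tailTest (h : IsRegularTail V R c) {a y : ℝ} {m : ℕ} (ha : R ≤ a)
    (hay : a < y) (hy : V y - V a < 1) :
    HasDerivAt (tailTest V a m) (m * (V y - V a) ^ (m - 1) * deriv V y) y := by
  have hV := h.hasDerivAt (ha.trans hay.le)
  refine ((hV.sub_const (V a)).fun_pow m).congr_of_eventuallyEq ?_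
  filter_upwards [Ioi_mem_nhds hay,
    (hV.continuousAt.sub continuousAt_const).eventually_lt continuousAt_const hy] with z hz hz'
  rw [Pi.sub_apply] at hz'
  rw [tailTest, max_eq_left (le_of_lt hz), min_eq_left hz'.le]

theorem deriv_tailTest_eq_zero (h : IsRegularTail V R c) {a y : ℝ} {m : ℕ} (ha : R ≤ a)
    (hay : a < y) (hy : 1 < V y - V a) : deriv (tailTest V a m) y = 0 := by
  have hV := h.hasDerivAt (ha.trans hay.le)
  have h1 : tailTest V a m =ᶠ[𝓝 y] fun _ => 1 := by
    filter_upwards [Ioi_mem_nhds hay, (continuousAt_const (y := (1 : ℝ))).eventually_lt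
      (hV.continuousAt.sub (continuousAt_const (y := V a))) hy] with z hz hz'
    rw [Pi.sub_apply] at hz'
    rw [tailTest, max_eq_left (le_of_lt hz), min_eq_right (le_of_lt hz'), one_pow]
  rw [h1.deriv_eq, deriv_const]

/-- The derivative lives where `V` climbs from `V a` to `V a + 1`, and there `V' ≤ e V'(a)`. One
factor `V'(y)` is kept so that `V' e^{-V}` integrates exactly. -/
theorem exists_modifiedEnergy_tailTest_le (h : IsRegularTail V R c) (hV : AEMeasurable V volume)
    {q : ℝ} {m : ℕ} (hq : 2 ≤ q) (hm : q ≤ 2 * m) :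
    ∃ B, 0 ≤ B ∧ ∀ a, R ≤ a → modifiedEnergy q (gibbsMeasure V) (tailTest V a m) ≤
      ENNReal.ofReal (B * deriv V a ^ (q - 1) * Real.exp (-V a)) := by
  have hc := h.pos
  have hm0 : m ≠ 0 := by
    rintro rfl
    norm_num at hm
    linarith
  set e := Real.exp 1 with he
  refine ⟨m ^ 2 * e * (c ^ (q - 2))⁻¹ + m ^ q * e ^ (q - 1), by positivity, fun a ha => ?_⟩
  set B := m ^ 2 * e * (c ^ (q - 2))⁻¹ + m ^ q * e ^ (q - 1) with hB
  have hB0 : 0 ≤ B := by positivity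
  have hA := h.deriv_pos ha
  have hcA := h.le_deriv a ha
  set A := deriv V a with hA'
  obtain ⟨b, hab, hb⟩ := h.exists_eq_add ha zero_le_one
  have hpt : ∀ y, a < y → y < b → modifiedPower q (deriv (tailTest V a m) y / tailTest V a m y) *
      tailTest V a m y ^ 2 ≤ B * A ^ (q - 1) * deriv V y := by
    intro y hay hyb
    have hRy := ha.trans hay.le
    have hs := h.deriv_pos hRy
    have hw : 0 < V y - V a :=
      (mul_pos hc (sub_pos.2 hay)).trans_le (h.mul_sub_le ha hay.le)
    have hw1 : V y - V a < 1 := by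
      have := (mul_pos hc (sub_pos.2 hyb)).trans_le (h.mul_sub_le hRy hyb.le)
      linarith
    have hfy : tailTest V a m y = (V y - V a) ^ m := by
      rw [tailTest, max_eq_left hay.le, min_eq_left hw1.le]
    have hratio : m * (V y - V a) ^ (m - 1) * deriv V y / (V y - V a) ^ m =
        m * deriv V y / (V y - V a) := by
      obtain ⟨k, rfl⟩ := Nat.exists_eq_succ_of_ne_zero hm0
      rw [Nat.succ_sub_one, pow_succ]
      field_simp
    rw [(h.hasDerivAt_tailTest ha hay hw1).deriv, hfy, hratio]
    refine (modifiedPower_div_mul_le hm0 hm (by positivity) hw hw1.le).trans ?_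
    have hsA : deriv V y ≤ e * A := by
      refine (h.deriv_le ha hay.le).trans ?_
      exact mul_le_mul_of_nonneg_right (Real.exp_le_exp.2 hw1.le) hA.le
    have h1 : (m * deriv V y) ^ 2 ≤ m ^ 2 * e * (c ^ (q - 2))⁻¹ * A ^ (q - 1) * deriv V y := by
      -- Since `A ≥ c` and `q ≥ 2`, the quadratic part of `H_q` is also controlled by `A^(q-1)`.
      have h2 : A ≤ (c ^ (q - 2))⁻¹ * A ^ (q - 1) := by
        have h3 : A ^ (q - 1) = A * A ^ (q - 2) := by
          rw [← Real.rpow_one_add' hA.le (by linarith)]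
          congr 1
          ring
        have h4 : c ^ (q - 2) ≤ A ^ (q - 2) := Real.rpow_le_rpow hc.le hcA (by linarith)
        rw [inv_mul_eq_div, le_div_iff₀ (by positivity), h3]
        gcongr
      calc (m * deriv V y) ^ 2 = m ^ 2 * deriv V y * deriv V y := by ring
        _ ≤ m ^ 2 * (e * ((c ^ (q - 2))⁻¹ * A ^ (q - 1))) * deriv V y := by
            gcongr
            exact hsA.trans (by gcongr)
        _ = _ := by ring
    have h2 : (m * deriv V y) ^ q ≤ m ^ q * e ^ (q - 1) * A ^ (q - 1) * deriv V y := by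
      have h3 : deriv V y ^ q = deriv V y ^ (q - 1) * deriv V y := by
        rw [mul_comm, ← Real.rpow_one_add' hs.le (by linarith)]
        congr 1
        ring
      rw [Real.mul_rpow (by positivity) hs.le, h3]
      calc m ^ q * (deriv V y ^ (q - 1) * deriv V y)
          ≤ m ^ q * ((e * A) ^ (q - 1) * deriv V y) := by gcongr; linarith
        _ = _ := by
            rw [Real.mul_rpow (by positivity) hA.le]
            ring
    rw [hB]
    linarith
  have hi : IntervalIntegrable (fun y => B * A ^ (q - 1) * max (deriv V y) 0 * Real.exp (-V y))
      volume a b := (h.mono ha).intervalIntegrable_mul_exp hab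
    (continuousOn_const.mul (((h.mono ha).continuousOn_deriv b).sup continuousOn_const))
  calc modifiedEnergy q (gibbsMeasure V) (tailTest V a m)
      ≤ ∫⁻ y, (Set.Ioc a b).indicator
          (fun y => ENNReal.ofReal (B * A ^ (q - 1) * max (deriv V y) 0)) y ∂gibbsMeasure V := by
        refine lintegral_mono_ae (ae_gibbsMeasure ?_)
        filter_upwards [Measure.ae_ne volume b] with y hyb
        rcases le_or_gt y a with hya | hya
        · rw [tailTest_of_le hm0 hya]
          simp
        rcases lt_or_gt_of_ne hyb with hyb | hyb
        · rw [Set.indicator_of_mem (show y ∈ Set.Ioc a b from ⟨hya, hyb.le⟩)]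
          refine ENNReal.ofReal_le_ofReal ((hpt y hya hyb).trans ?_)
          gcongr
          exact le_max_left _ _
        · have hw1 : 1 < V y - V a := by
            have := (mul_pos hc (sub_pos.2 hyb)).trans_le (h.mul_sub_le (ha.trans hab) hyb.le)
            linarith
          rw [h.deriv_tailTest_eq_zero ha hya hw1, zero_div]
          simp [modifiedPower, Real.zero_rpow (by linarith : q ≠ 0)]
    _ = ENNReal.ofReal (∫ y in a..b, B * A ^ (q - 1) * max (deriv V y) 0 * Real.exp (-V y)) := by
        rw [lintegral_indicator measurableSet_Ioc, setLIntegral_Ioc_gibbsMeasure hV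
          (by have := measurable_deriv V; fun_prop) (fun y => by positivity) hab hi]
    _ ≤ _ := by
        refine ENNReal.ofReal_le_ofReal ?_
        have h1 : ∫ y in a..b, B * A ^ (q - 1) * max (deriv V y) 0 * Real.exp (-V y) =
            B * A ^ (q - 1) * ∫ y in a..b, deriv V y * Real.exp (-V y) := by
          rw [← intervalIntegral.integral_const_mul]
          refine intervalIntegral.integral_congr fun y hy => ?_
          rw [Set.uIcc_of_le hab] at hy
          rw [max_eq_left (h.deriv_pos (ha.trans hy.1)).le]
          ring
        rw [h1, h.integral_deriv_mul_exp ha hab]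
        gcongr
        linarith [Real.exp_pos (-V b)]

/-- The test function is `1` where `V` runs from `V a + 1` to `V a + 2`; there `V' ≤ e² V'(a)`, so
`e^{-V} ≥ e^{-2} V' e^{-V} / V'(a)`, which integrates exactly. -/
theorem le_integral_tailTest_sq (h : IsRegularTail V R c) (hV : AEMeasurable V volume)
    (hμ : IsProbabilityMeasure (gibbsMeasure V)) {a : ℝ} (ha : R ≤ a) (m : ℕ) :
    (Real.exp (-1) - Real.exp (-2)) * Real.exp (-2) * Real.exp (-V a) / deriv V a ≤
      ∫ y, tailTest V a m y ^ 2 ∂gibbsMeasure V := by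
  have hc := h.pos
  have hA := h.deriv_pos ha
  obtain ⟨b, hab, hb⟩ := h.exists_eq_add ha zero_le_one
  obtain ⟨d, had, hd⟩ := h.exists_eq_add ha zero_le_two
  have hbd : b ≤ d := by
    by_contra! hlt
    have := h.mul_sub_le (ha.trans had) hlt.le
    nlinarith
  have hRb := ha.trans hab
  have hm := (h.locallyLipschitz_tailTest ha m).continuous.measurable
  have hi : IntervalIntegrable (fun z => 1 * Real.exp (-V z)) volume b d :=
    (h.mono hRb).intervalIntegrable_mul_exp hbd continuousOn_const
  have h1 : ENNReal.ofReal (∫ z in b..d, 1 * Real.exp (-V z)) ≤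
      ∫⁻ y, ENNReal.ofReal (tailTest V a m y ^ 2) ∂gibbsMeasure V := by
    rw [← setLIntegral_Ioc_gibbsMeasure hV measurable_const (fun _ => zero_le_one) hbd hi]
    refine le_trans ?_ (setLIntegral_le_lintegral (Set.Ioc b d) _)
    refine setLIntegral_mono' measurableSet_Ioc fun y hy => ENNReal.ofReal_le_ofReal ?_
    have h2 := h.mul_sub_le hRb hy.1.le
    have h3 : 1 ≤ V y - V a := by nlinarith [hy.1]
    rw [tailTest, max_eq_left (hab.trans hy.1.le), min_eq_right h3]
    simp
  have hfi : Integrable (fun y => tailTest V a m y ^ 2) (gibbsMeasure V) :=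
    Integrable.of_bound (hm.pow_const 2).aestronglyMeasurable 1 (ae_of_all _ fun y => by
      have := h.tailTest_mem_Icc ha m y
      rw [Real.norm_eq_abs, abs_of_nonneg (sq_nonneg _)]
      exact pow_le_one₀ this.1 this.2)
  rw [← ofReal_integral_eq_lintegral_ofReal hfi (ae_of_all _ fun y => sq_nonneg _),
    ENNReal.ofReal_le_ofReal_iff (integral_nonneg fun y => sq_nonneg _)] at h1
  refine le_trans ?_ h1
  have h2 := h.integral_deriv_mul_exp hRb hbd
  have h3 : ∫ z in b..d, deriv V z * Real.exp (-V z) ≤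
      ∫ z in b..d, Real.exp 2 * deriv V a * (1 * Real.exp (-V z)) := by
    refine intervalIntegral.integral_mono_on hbd ((h.mono hRb).intervalIntegrable_mul_exp hbd
      ((h.mono hRb).continuousOn_deriv d)) (hi.const_mul _) fun z hz => ?_
    rw [one_mul]
    refine mul_le_mul_of_nonneg_right ?_ (Real.exp_nonneg _)
    refine (h.deriv_le ha (hab.trans hz.1)).trans ?_
    gcongr
    have := h.mul_sub_le (hRb.trans hz.1) hz.2
    nlinarith [hz.2]
  rw [h2, intervalIntegral.integral_const_mul, hb, hd, neg_add, neg_add, Real.exp_add,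
    Real.exp_add] at h3
  rw [div_le_iff₀ hA]
  have h4 : Real.exp (-2) * Real.exp 2 = 1 := by rw [← Real.exp_add]; simp
  have h5 := mul_le_mul_of_nonneg_left h3 (Real.exp_nonneg (-2))
  calc _ = Real.exp (-2) *
        (Real.exp (-V a) * Real.exp (-1) - Real.exp (-V a) * Real.exp (-2)) := by ring
    _ ≤ _ := h5
    _ = Real.exp (-2) * Real.exp 2 *
        ((∫ z in b..d, 1 * Real.exp (-V z)) * deriv V a) := by ring
    _ = _ := by rw [h4, one_mul]

theorem exists_le_mul_rpow (h : IsRegularTail V R c) (hV : AEMeasurable V volume)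
    (hμ : IsProbabilityMeasure (gibbsMeasure V)) {q : ℝ} (hq : 2 ≤ q) {κ : ℝ≥0}
    (hκ : ∀ f : ℝ → ℝ, LocallyLipschitz f →
      boltzmannEntropy (gibbsMeasure V) (fun x => f x ^ 2) ≤
        (κ : ℝ≥0∞) * modifiedEnergy q (gibbsMeasure V) f) :
    ∃ C, ∀ a, R ≤ a → V a ≤ C * deriv V a ^ q := by
  obtain ⟨m, hm⟩ : ∃ m : ℕ, q ≤ 2 * m := by
    obtain ⟨m, hm⟩ := exists_nat_ge q
    exact ⟨m, by linarith⟩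
  have hm0 : m ≠ 0 := by
    rintro rfl
    norm_num at hm
    linarith
  have hc := h.pos
  obtain ⟨B, hB0, hB⟩ := h.exists_modifiedEnergy_tailTest_le hV hq hm
  set k := (Real.exp (-1) - Real.exp (-2)) * Real.exp (-2) with hk
  have hk0 : 0 < k := mul_pos (sub_pos.2 (Real.exp_lt_exp.2 (by norm_num))) (Real.exp_pos _)
  -- The first summand absorbs `log c`, coming from the tail mass bound, by means of `V' ≥ c`.
  refine ⟨|Real.log c| * (c ^ q)⁻¹ + κ * B / k, fun a ha => ?_⟩
  have hA := h.deriv_pos ha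
  have hcA : c ^ q ≤ deriv V a ^ q := Real.rpow_le_rpow hc.le (h.le_deriv a ha) (by linarith)
  have hlip := h.locallyLipschitz_tailTest ha m
  have hmem := h.tailTest_mem_Icc ha m
  have hl := h.le_integral_tailTest_sq hV hμ ha m
  rw [← hk] at hl
  set l := ∫ y, tailTest V a m y ^ 2 ∂gibbsMeasure V with hl'
  have hl0 : 0 < l := lt_of_lt_of_le (by positivity) hl
  obtain ⟨hi, hent⟩ := mul_le_integral_mul_log (μ := gibbsMeasure V) (s := Set.Ioi a)
    (g := fun y => tailTest V a m y ^ 2) measurableSet_Ioi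
    (hlip.continuous.measurable.pow_const 2) (fun y => sq_nonneg _)
    (fun y => pow_le_one₀ (hmem y).1 (hmem y).2)
    (fun y hy => by rw [tailTest_of_le hm0 (not_lt.1 hy)]; simp) hl0
  have h1 := hκ _ hlip
  rw [boltzmannEntropy, if_pos hi] at h1
  have h2 : l * -Real.log ((gibbsMeasure V).real (Set.Ioi a)) ≤
      κ * (B * deriv V a ^ (q - 1) * Real.exp (-V a)) := by
    refine hent.trans ?_
    rw [← ENNReal.ofReal_le_ofReal_iff (by positivity)]
    refine h1.trans ?_
    rw [ENNReal.ofReal_mul κ.coe_nonneg, ENNReal.ofReal_coe_nnreal]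
    gcongr
    exact hB a ha
  have h3 : V a + Real.log c ≤ -Real.log ((gibbsMeasure V).real (Set.Ioi a)) := by
    have h4 : (gibbsMeasure V).real (Set.Ioi a) ≤ Real.exp (-V a) / c :=
      ENNReal.toReal_le_of_le_ofReal (by positivity) (h.gibbsMeasure_Ioi_le hV ha)
    have h5 : 0 < (gibbsMeasure V).real (Set.Ioi a) := by
      refine measureReal_nonneg.lt_of_ne' fun h0 => ?_
      have h6 : (fun y => tailTest V a m y ^ 2) =ᵐ[gibbsMeasure V] 0 := by
        rw [measureReal_eq_zero_iff] at h0
        filter_upwards [measure_eq_zero_iff_ae_notMem.1 h0] with y hy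
        rw [tailTest_of_le hm0 (not_lt.1 hy)]
        simp
      exact hl0.ne' (integral_eq_zero_of_ae h6)
    have h6 := Real.log_le_log h5 h4
    rw [Real.log_div (Real.exp_ne_zero _) hc.ne', Real.log_exp] at h6
    linarith
  have hmain : V a + Real.log c ≤ κ * B / k * deriv V a ^ q := by
    -- The lower bound for the norm may be multiplied in only when this factor is non-negative;
    -- otherwise the claim is trivial.
    rcases le_or_gt (V a + Real.log c) 0 with h7 | h7
    · exact h7.trans (by positivity)
    · have h8 : k * Real.exp (-V a) / deriv V a * (V a + Real.log c) ≤
          κ * (B * deriv V a ^ (q - 1) * Real.exp (-V a)) :=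
        (mul_le_mul hl h3 h7.le hl0.le).trans h2
      have h9 : deriv V a ^ q = deriv V a ^ (q - 1) * deriv V a := by
        rw [mul_comm, ← Real.rpow_one_add' hA.le (by linarith)]
        congr 1
        ring
      rw [div_mul_eq_mul_div, div_le_iff₀ hA] at h8
      rw [h9, div_mul_eq_mul_div, le_div_iff₀ hk0]
      refine le_of_mul_le_mul_right ?_ (Real.exp_pos (-V a))
      linarith
  have hlog : |Real.log c| ≤ |Real.log c| * (c ^ q)⁻¹ * deriv V a ^ q := by
    rw [mul_assoc]
    refine le_mul_of_one_le_right (abs_nonneg _) ?_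
    rw [inv_mul_eq_div, one_le_div (by positivity)]
    exact hcA
  rw [add_mul]
  linarith [neg_abs_le (Real.log c)]

end IsRegularTail

/-! ### The criterion -/

theorem boltzmannEntropy_comp_neg (V g : ℝ → ℝ) :
    boltzmannEntropy (gibbsMeasure fun x => V (-x)) g =
      boltzmannEntropy (gibbsMeasure V) fun x => g (-x) := by
  have h : (gibbsMeasure V).map Neg.neg = (gibbsMeasure V).map (MeasurableEquiv.neg ℝ) := rfl
  have hi : Integrable (fun x => g x * Real.log (1 + g x))
      ((gibbsMeasure V).map (MeasurableEquiv.neg ℝ)) ↔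
      Integrable (fun x => g (-x) * Real.log (1 + g (-x))) (gibbsMeasure V) :=
    integrable_map_equiv _ _
  rw [boltzmannEntropy, boltzmannEntropy, gibbsMeasure_comp_neg, h]
  by_cases hg : Integrable (fun x => g (-x) * Real.log (1 + g (-x))) (gibbsMeasure V)
  · rw [if_pos (hi.2 hg), if_pos hg]
    simp only [integral_map_equiv]
    rfl
  · rw [if_neg (mt hi.1 hg), if_neg hg]

/-- Non-negativity of `V` follows from its linear growth: `V` is non-negative once `x ≥ T + |V T| /
c`. -/
theorem eventually_isRegularTail {V : ℝ → ℝ} {c : ℝ} (hc : 0 < c)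
    (hV : ∃ S, ContDiffOn ℝ 2 V (Set.Ioi S)) (h1 : ∀ᶠ x in atTop, c ≤ deriv V x)
    (h2 : ∀ᶠ x in atTop, |iteratedDeriv 2 V x / deriv V x ^ 2| ≤ 1 / 4) :
    ∀ᶠ R in atTop, IsRegularTail V R c := by
  obtain ⟨S, hS⟩ := hV
  obtain ⟨T, hT⟩ := eventually_atTop.1 (h1.and (h2.and (eventually_gt_atTop S)))
  have hlow : ∀ x, T ≤ x → V T + c * (x - T) ≤ V x := by
    intro x hx
    have hd : ∀ z, T ≤ z → DifferentiableAt ℝ V z := fun z hz =>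
      (hS.contDiffAt (Ioi_mem_nhds (hT z hz).2.2)).differentiableAt (by norm_num)
    have := (convex_Icc T x).mul_sub_le_image_sub_of_le_deriv
      (fun z hz => (hd z hz.1).continuousAt.continuousWithinAt)
      (fun z hz => (hd z (interior_subset hz).1).differentiableWithinAt)
      (fun z hz => (hT z (interior_subset hz).1).1) T ⟨le_rfl, hx⟩ x ⟨hx, le_rfl⟩ hx
    linarith
  filter_upwards [eventually_ge_atTop T, eventually_ge_atTop (T + |V T| / c)] with R hR hR'
  refine ⟨hc, ⟨S, (hT R hR).2.2, hS⟩, fun x hx => ?_, fun x hx => (hT x (hR.trans hx)).1,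
    fun x hx => ?_⟩
  · have h3 := hlow x (hR.trans hx)
    have h4 : |V T| / c ≤ x - T := by linarith
    rw [div_le_iff₀ hc] at h4
    linarith [neg_abs_le (V T)]
  · obtain ⟨h3, h4, -⟩ := hT x (hR.trans hx)
    have h5 : 0 < deriv V x ^ 2 := pow_pos (hc.trans_le h3) 2
    rw [abs_div, abs_of_pos h5, div_le_iff₀ h5, iteratedDeriv_succ, iteratedDeriv_one] at h4
    linarith

theorem exists_forall_mem_Icc_le_of_locally_bounded {V : ℝ → ℝ}
    (hV : ∀ x : ℝ, ∃ C : ℝ, ∀ᶠ y in 𝓝 x, |V y| ≤ C) (a b : ℝ) :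
    ∃ B, ∀ x ∈ Set.Icc a b, V x ≤ B := by
  refine isCompact_Icc.induction_on (p := fun s => ∃ B, ∀ x ∈ s, V x ≤ B) ⟨0, by simp⟩
    (fun s t hst ⟨B, hB⟩ => ⟨B, fun x hx => hB x (hst hx)⟩) ?_ ?_
  · rintro s t ⟨B, hB⟩ ⟨C, hC⟩
    refine ⟨max B C, fun x hx => ?_⟩
    rcases hx with hx | hx
    · exact (hB x hx).trans (le_max_left _ _)
    · exact (hC x hx).trans (le_max_right _ _)
  · intro x _
    obtain ⟨C, hC⟩ := hV x
    exact ⟨_, mem_nhdsWithin_of_mem_nhds hC, C, fun y hy => (le_abs_self _).trans hy⟩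

theorem limsup_lt_top_iff {f : Filter ℝ} {u : ℝ → ℝ} :
    limsup (fun x => (u x : EReal)) f < ⊤ ↔ ∃ C : ℝ, ∀ᶠ x in f, u x ≤ C := by
  constructor
  · intro h
    obtain ⟨C, hC, -⟩ := EReal.lt_iff_exists_real_btwn.1 h
    refine ⟨C, (eventually_lt_of_limsup_lt hC).mono fun x hx => ?_⟩
    exact_mod_cast hx.le
  · rintro ⟨C, hC⟩
    refine lt_of_le_of_lt (limsup_le_of_le ?_ (hC.mono fun x hx => ?_)) (EReal.coe_lt_top C)
    · isBoundedDefault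
    · exact_mod_cast hx

theorem eventually_cocompact_real_iff {p : ℝ → Prop} :
    (∀ᶠ x in cocompact ℝ, p x) ↔ (∀ᶠ x in atTop, p x) ∧ ∀ᶠ x in atTop, p (-x) := by
  rw [cocompact_eq_atBot_atTop, eventually_sup, and_comm, ← map_neg_atTop, eventually_map]

theorem mainTheorem1 (q : ℝ) (hq : 2 ≤ q) (V : ℝ → ℝ)
    (hVmeas : AEMeasurable V volume)
    (hprob : IsProbabilityMeasure (gibbsMeasure V))
    (hVbdd : ∀ x : ℝ, ∃ C : ℝ, ∀ᶠ y in 𝓝 x, |V y| ≤ C)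
    (hVsmooth : ∃ R : ℝ, ContDiffOn ℝ 2 V (Set.Ioi R) ∧ ContDiffOn ℝ 2 V (Set.Iio (-R)))
    (hV1 : (0 : EReal) <
      liminf (fun x : ℝ => ((Real.sign x * deriv V x : ℝ) : EReal)) (cocompact ℝ))
    (hV2 : Tendsto (fun x : ℝ => iteratedDeriv 2 V x / (deriv V x) ^ 2) (cocompact ℝ) (𝓝 0)) :
    (∃ κ : ℝ≥0, ∀ f : ℝ → ℝ, LocallyLipschitz f →
        boltzmannEntropy (gibbsMeasure V) (fun x => f x ^ 2) ≤
          (κ : ℝ≥0∞) * modifiedEnergy q (gibbsMeasure V) f) ↔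
      limsup (fun x : ℝ => ((V x / |deriv V x| ^ q : ℝ) : EReal)) (cocompact ℝ) < ⊤ := by
  obtain ⟨S, hS, hS'⟩ := hVsmooth
  -- A real `c` strictly below the lower limit also covers the case where that limit is infinite.
  obtain ⟨c, hc, hc'⟩ := EReal.lt_iff_exists_real_btwn.1 hV1
  replace hc : 0 < c := by exact_mod_cast hc
  have hW : ∀ x, deriv (fun x => V (-x)) x = -deriv V (-x) := fun x => deriv_comp_neg V x
  have hW2 : ∀ x, iteratedDeriv 2 (fun x => V (-x)) x = iteratedDeriv 2 V (-x) := fun x => by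
    rw [iteratedDeriv_comp_neg]
    simp
  obtain ⟨h1, h1'⟩ := eventually_cocompact_real_iff.1 (eventually_lt_of_lt_liminf hc')
  obtain ⟨h2, h2'⟩ := eventually_cocompact_real_iff.1
    ((tendsto_order.1 hV2.abs).2 (1 / 4) (by norm_num))
  have hright : ∀ᶠ R in atTop, IsRegularTail V R c := by
    refine eventually_isRegularTail hc ⟨S, hS⟩ ?_ (h2.mono fun x hx => hx.le)
    filter_upwards [h1, eventually_gt_atTop 0] with x hx hx0
    rw [Real.sign_of_pos hx0, one_mul] at hx
    exact_mod_cast hx.le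
  have hleft : ∀ᶠ R in atTop, IsRegularTail (fun x => V (-x)) R c := by
    refine eventually_isRegularTail hc ⟨S, ?_⟩ ?_ ?_
    · exact hS'.comp (by fun_prop) fun x hx => neg_lt_neg (Set.mem_Ioi.1 hx)
    · filter_upwards [h1', eventually_gt_atTop 0] with x hx hx0
      rw [Real.sign_of_neg (by linarith), neg_one_mul] at hx
      rw [hW]
      exact_mod_cast hx.le
    · filter_upwards [h2'] with x hx
      rw [hW, hW2, neg_sq]
      exact hx.le
  have htails : ∀ᶠ R in atTop, HasRegularTails V R c := by
    filter_upwards [hright, hleft, eventually_ge_atTop 0] with R hr hl hR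
    exact ⟨hR, hr, hl, exists_forall_mem_Icc_le_of_locally_bounded hVbdd _ _⟩
  rw [limsup_lt_top_iff]
  constructor
  · rintro ⟨κ, hκ⟩
    obtain ⟨R, hR⟩ := htails.exists
    obtain ⟨C₁, hC₁⟩ := hR.right.exists_le_mul_rpow hVmeas hprob hq hκ
    -- The left tail is the right tail of the reflected potential, which satisfies the same
    -- inequality with the same `κ`.
    obtain ⟨C₂, hC₂⟩ := hR.left.exists_le_mul_rpow (κ := κ) (aemeasurable_comp_neg hVmeas)
      (isProbabilityMeasure_comp_neg hprob) hq fun f hf => by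
        rw [boltzmannEntropy_comp_neg]
        refine (hκ _ hf.comp_neg).trans (le_of_eq ?_)
        rw [← modifiedEnergy_comp_neg]
        simp only [neg_neg]
    refine ⟨max C₁ C₂, eventually_cocompact_real_iff.2 ⟨?_, ?_⟩⟩
    · filter_upwards [eventually_ge_atTop R] with x hx
      have hp := hR.right.deriv_pos hx
      rw [abs_of_pos hp, div_le_iff₀ (by positivity)]
      exact (hC₁ x hx).trans (by gcongr; exact le_max_left _ _)
    · filter_upwards [eventually_ge_atTop R] with x hx
      have hp := hR.left.deriv_pos hx
      have h3 := hC₂ x hx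
      rw [hW] at hp h3
      rw [← abs_neg, abs_of_pos hp, div_le_iff₀ (by positivity)]
      exact h3.trans (by gcongr; exact le_max_right _ _)
  · rintro ⟨C, hC⟩
    obtain ⟨hC, hC'⟩ := eventually_cocompact_real_iff.1 hC
    obtain ⟨T, hT⟩ := eventually_atTop.1 (hC.and hC')
    obtain ⟨R, hR, hTR⟩ := (htails.and (eventually_ge_atTop T)).exists
    refine hR.exists_boltzmannEntropy_le (C₀ := max C 0) hVmeas hprob hq (le_max_right _ _)
      (fun x hx => ?_) fun x hx => ?_
    · have hp := hR.right.deriv_pos hx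
      have h3 := (hT x (hTR.trans hx)).1
      rw [abs_of_pos hp, div_le_iff₀ (by positivity)] at h3
      exact h3.trans (by gcongr; exact le_max_left _ _)
    · have hp := hR.left.deriv_pos hx
      have h3 := (hT x (hTR.trans hx)).2
      rw [hW] at hp ⊢
      rw [← abs_neg, abs_of_pos hp, div_le_iff₀ (by positivity)] at h3
      exact h3.trans (by gcongr; exact le_max_left _ _)
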